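/- Let $q$ be a prime power, let $n\ge 1$ be an odd integer, and let $0\le k\le n$. Regard $V=\mathbb F_{q^{2n}}$ as an $n$-dimensional vector space over $\mathbb F_{q^2}$ with the Hermitian form $$(\alpha,\beta):=\mathrm{Tr}_{\mathbb F_{q^{2n}}/\mathbb F_{q^2}}\bigl(\alpha\,\beta^{q^n}\bigr).$$ Call an $\mathbb F_{q^2}$-subspace $W\subseteq V$ nondegenerate if the only $\alpha\in W$ with $(\alpha,\beta)=0$ for all $\beta\in W$ is $\alpha=0$, and let $X$ be the set of all nondegenerate $k$-dimensional $\mathbb F_{q^2}$-subspaces of $V$. Let $\gamma$ be a generator of the cyclic group $\mathbb F_{q^{2n}}^\times$ and let $C:=\langle\gamma^{q^n-1}\rangle$, acting on subspaces of $V$ by $W\mapsto cW$. Put $$X(t):=t^E\cdot\prod_{i=0}^{k-1}\frac{1-t^{q^n+(-q)^{n-k+i}}}{1-t^{q^k-(-1)^k(-q)^i}}\cdot\prod_{i=0}^{k-1}\frac{1-t^{q^n+(-q)^i}}{1-t^{q^k-(-1)^k(-q)^i}},$$ where $E:=0$ if $k$ is odd and $E:=2\sum_{i=0}^{k-1}\bigl(q^k-(-q)^i\bigr)$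 if $k$ is even. Then $C\cong\mathbb Z/(q^n+1)\mathbb Z$, the group $C$ permutes $X$, the rational function $X(t)$ is a polynomial in $t$ with nonnegative integer coefficients, and the triple $(X,X(t),C)$ exhibits the cyclic sieving phenomenon: for every $c\in C$ and every complex root of unity $\omega$ whose multiplicative order equals that of $c$, $$\#\{W\in X: cW=W\}=X(\omega).$$ -/

import Mathlib

open scoped Pointwise

noncomputable section

/-- The cyclic sieving phenomenon for `(X, P, C)`: `C` is a finite cyclic group, `X` is a finite
set (inside a type on which `C` acts) that `C` permutes, `P` is a polynomial with nonnegative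
integer coefficients, and for every `c ∈ C` and every complex root of unity `ω` of the same
multiplicative order as `c`, the number of `x ∈ X` with `c • x = x` is `P(ω)`. -/
structure CyclicSieving {S : Type*} (C : Type*) [Group C] [MulAction C S]
    (X : Set S) (P : Polynomial ℕ) : Prop where
  finite_group : Finite C
  isCyclic : IsCyclic C
  finite_set : X.Finite
  smul_mem : ∀ (c : C), ∀ x ∈ X, c • x ∈ X
  card_fixed : ∀ (c : C) (ω : ℂ), orderOf ω = orderOf c →
    (Set.ncard {x : S | x ∈ X ∧ c • x = x} : ℂ) = Polynomial.aeval ω P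

/-- The trace Hermitian form `(α, β) = Tr_{L/K}(α β^(q^n))`, where `K = 𝔽_{q²}` and
`L = 𝔽_{q^{2n}}`. -/
def traceForm (q n : ℕ) (K : Type*) {L : Type*} [Field K] [Field L] [Algebra K L]
    (α β : L) : K :=
  Algebra.trace K L (α * β ^ (q ^ n))

/-- A `K`-subspace `W` of `L` is nondegenerate if the restriction of the form to `W` is. -/
def IsNondegenerateSubspace (q n : ℕ) {K L : Type*} [Field K] [Field L] [Algebra K L]
    (W : Submodule K L) : Prop :=
  ∀ α ∈ W, (∀ β ∈ W, traceForm q n K α β = 0) → α = 0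

/-- The set of nondegenerate `k`-dimensional `K`-subspaces of `L`. -/
def nondegenerateSubspaces (q n k : ℕ) (K L : Type*) [Field K] [Field L] [Algebra K L] :
    Set (Submodule K L) :=
  {W | Module.finrank K W = k ∧ IsNondegenerateSubspace q n W}

/-- The exponent `E`. -/
def sievingExponent (q k : ℕ) : ℤ :=
  if Odd k then 0 else 2 * ∑ i ∈ Finset.range k, ((q : ℤ) ^ k - (-(q : ℤ)) ^ i)

/-- The rational function `X(t)`; the exponents of `t` are integers. -/
def sievingFunction (q n k : ℕ) : RatFunc ℚ :=
  let t : RatFunc ℚ := RatFunc.X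
  t ^ sievingExponent q k *
    (∏ i ∈ Finset.range k,
      (1 - t ^ ((q : ℤ) ^ n + (-(q : ℤ)) ^ (n - k + i))) /
        (1 - t ^ ((q : ℤ) ^ k - (-1) ^ k * (-(q : ℤ)) ^ i))) *
    (∏ i ∈ Finset.range k,
      (1 - t ^ ((q : ℤ) ^ n + (-(q : ℤ)) ^ i)) /
        (1 - t ^ ((q : ℤ) ^ k - (-1) ^ k * (-(q : ℤ)) ^ i)))

end

/-!
Put `Q = -q`. Since `n` is odd, `X(t)` is, at `u = t⁻¹`, a ratio of Reiner–Stanton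
`(q, t)`-factorials times a `(q, t)`-binomial coefficient, both with `Q` in place of `q`. The
`(q, t)`-Pascal recursions show by induction on the upper index that the `(q, t)`-binomial is, up
to sign, a Laurent polynomial with nonnegative coefficients, and `X(t)` has no pole at `0`.

An element `c` of `C` fixes `W` exactly when `W` is a subspace over `M = K(c)`, and then `W` is
nondegenerate for the trace form to `K` if and only if it is so for the trace form to `M`. So the
fixed points of `c` are the nondegenerate subspaces of a Hermitian space over `M`. They are counted
recursively, by counting the pairs of a subspace and an anisotropic vector in it: the orthogonal
complement of the vector lowers both dimensions by one.

On the other side, let `m` be the multiplicative order of `Q` modulo the order of `c`. Since `n` is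
odd, this is the degree of `M` over `K`. At `u = ω⁻¹` a factor `1 - u^(Q^a - Q^b)` vanishes exactly
when `a ≡ b` modulo `m`. Comparing derivatives in these factors evaluates `X(ω)` as a product over
`Q^m`, the one that counts the fixed points.
-/

namespace HermitianSieving

open Finset Polynomial

section QTBinomial

lemma zpow_eq_one_iff_orderOf_dvd {G₀ : Type*} [GroupWithZero G₀] (u : G₀) (m : ℤ) :
    u ^ m = 1 ↔ (orderOf u : ℤ) ∣ m := by
  rcases eq_or_ne u 0 with rfl | hu
  · simp [zero_zpow_eq_one₀]
  · lift u to G₀ˣ using hu.isUnit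
    rw [orderOf_units, orderOf_dvd_iff_zpow_eq_one]
    norm_cast

variable {F : Type*} [Field F] {u : F}

lemma zpow_eq_one_iff_of_not_isOfFinOrder (hu : ¬ IsOfFinOrder u) (m : ℤ) :
    u ^ m = 1 ↔ m = 0 := by
  rw [zpow_eq_one_iff_orderOf_dvd, orderOf_eq_zero hu, Nat.cast_zero, zero_dvd_iff]

lemma not_isOfFinOrder_zpow (hu : ¬ IsOfFinOrder u) {m : ℤ} (hm : m ≠ 0) :
    ¬ IsOfFinOrder (u ^ m) := by
  simp only [isOfFinOrder_iff_pow_eq_one, ← zpow_natCast, ← zpow_mul,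
    zpow_eq_one_iff_of_not_isOfFinOrder hu]
  rintro ⟨n, hn, h⟩
  simp [hm, hn.ne'] at h

lemma one_sub_zpow_ne_zero (hu : ¬ IsOfFinOrder u) {m : ℤ} (hm : m ≠ 0) : 1 - u ^ m ≠ 0 := by
  rwa [sub_ne_zero, ne_comm, Ne, zpow_eq_one_iff_of_not_isOfFinOrder hu]

lemma pow_sub_pow_ne_zero {Q : ℤ} (hQ : 2 ≤ |Q|) {i k : ℕ} (h : i < k) : Q ^ k - Q ^ i ≠ 0 := by
  refine sub_ne_zero.2 fun he ↦ (pow_lt_pow_right₀ (by linarith : 1 < |Q|) h).ne' ?_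
  rw [← abs_pow, ← abs_pow, he]

/-- The product `∏_{i < k} (1 - u^(Q^n - Q^i))`; for `k = n` this is the `(q, t)`-factorial of
Reiner and Stanton, at `t = u` and with the (possibly negative) integer `Q` for `q`. -/
def qtDescFactorial (Q : ℤ) (n k : ℕ) (u : F) : F :=
  ∏ i ∈ range k, (1 - u ^ (Q ^ n - Q ^ i))

/-- The `(q, t)`-binomial coefficient of Reiner and Stanton, at `t = u` and with the (possibly
negative) integer `Q` for `q`. -/
def qtBinomial (Q : ℤ) (n k : ℕ) (u : F) : F :=
  qtDescFactorial Q n k u / qtDescFactorial Q k k u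

/-- The ratio of the `(q, t)`-factorials of `k` at `t = u^(Q^r)` and at `t = u`. -/
def qtFactorialRatio (Q : ℤ) (r k : ℕ) (u : F) : F :=
  qtDescFactorial Q k k (u ^ Q ^ r) / qtDescFactorial Q k k u

lemma qtDescFactorial_succ_right (Q : ℤ) (n k : ℕ) (u : F) :
    qtDescFactorial Q n (k + 1) u = qtDescFactorial Q n k u * (1 - u ^ (Q ^ n - Q ^ k)) :=
  prod_range_succ ..

lemma qtDescFactorial_succ_succ (Q : ℤ) (n k : ℕ) (u : F) :
    qtDescFactorial Q (n + 1) (k + 1) u =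
      qtDescFactorial Q n k (u ^ Q) * (1 - u ^ (Q ^ (n + 1) - 1)) := by
  rw [qtDescFactorial, prod_range_succ', qtDescFactorial, pow_zero]
  congr! 3
  rw [← zpow_mul]
  ring_nf

lemma qtDescFactorial_eq_zero_of_lt (Q : ℤ) {n k : ℕ} (h : n < k) (u : F) :
    qtDescFactorial Q n k u = 0 :=
  prod_eq_zero (mem_range.2 h) (by simp)

lemma qtDescFactorial_self_ne_zero {Q : ℤ} (hQ : 2 ≤ |Q|) (k : ℕ) (hu : ¬ IsOfFinOrder u) :
    qtDescFactorial Q k k u ≠ 0 :=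
  prod_ne_zero_iff.2 fun _ hi ↦
    one_sub_zpow_ne_zero hu (pow_sub_pow_ne_zero hQ (mem_range.1 hi))

lemma qtBinomial_succ_succ (Q : ℤ) (n k : ℕ) (u : F) :
    qtBinomial Q (n + 1) (k + 1) u =
      qtBinomial Q n k (u ^ Q) * ((1 - u ^ (Q ^ (n + 1) - 1)) / (1 - u ^ (Q ^ (k + 1) - 1))) := by
  rw [qtBinomial, qtBinomial, qtDescFactorial_succ_succ, qtDescFactorial_succ_succ,
    mul_div_mul_comm]

lemma qtFactorialRatio_one_succ (Q : ℤ) (k : ℕ) (u : F) :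
    qtFactorialRatio Q 1 (k + 1) u = qtFactorialRatio Q 1 k (u ^ Q) *
      ((1 - (u ^ (Q ^ (k + 1) - 1)) ^ Q) / (1 - u ^ (Q ^ (k + 1) - 1))) := by
  rw [qtFactorialRatio, qtFactorialRatio, qtDescFactorial_succ_succ, qtDescFactorial_succ_succ,
    mul_div_mul_comm, pow_one, zpow_comm u (Q ^ (k + 1) - 1)]

lemma qtFactorialRatio_mul_qtBinomial {Q : ℤ} (hQ : 2 ≤ |Q|) (n k : ℕ) (hu : ¬ IsOfFinOrder u) :
    qtFactorialRatio Q 1 (k + 1) u * qtBinomial Q n (k + 1) (u ^ Q) =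
      qtBinomial Q n k (u ^ Q) *
        ((1 - u ^ (Q ^ (n + 1) - Q ^ (k + 1))) / (1 - u ^ (Q ^ (k + 1) - 1))) := by
  have huQ : ¬ IsOfFinOrder (u ^ Q) := not_isOfFinOrder_zpow hu (by rintro rfl; simp at hQ)
  rw [qtFactorialRatio, qtBinomial, qtBinomial, pow_one, mul_comm,
    div_mul_div_cancel₀ (qtDescFactorial_self_ne_zero hQ _ huQ), qtDescFactorial_succ_right,
    qtDescFactorial_succ_succ, mul_div_mul_comm, ← zpow_mul]
  ring_nf

lemma qtBinomial_pascal {Q : ℤ} (hQ : 2 ≤ |Q|) (n k : ℕ) (hu : ¬ IsOfFinOrder u) (hu₀ : u ≠ 0) :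
    qtBinomial Q (n + 1) (k + 1) u = qtBinomial Q n k (u ^ Q) +
      u ^ (Q ^ (k + 1) - 1) *
        (qtFactorialRatio Q 1 (k + 1) u * qtBinomial Q n (k + 1) (u ^ Q)) := by
  have hs := one_sub_zpow_ne_zero hu (pow_sub_pow_ne_zero hQ k.succ_pos)
  rw [pow_zero] at hs
  rw [qtBinomial_succ_succ, qtFactorialRatio_mul_qtBinomial hQ n k hu,
    ← sub_add_sub_cancel' (Q ^ (k + 1)), zpow_add₀ hu₀]
  field_simp
  ring

lemma qtBinomial_pascal_dual {Q : ℤ} (hQ : 2 ≤ |Q|) (n k : ℕ) (hu : ¬ IsOfFinOrder u)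
    (hu₀ : u ≠ 0) :
    qtBinomial Q (n + 1) (k + 1) u =
      qtFactorialRatio Q 1 (k + 1) u * qtBinomial Q n (k + 1) (u ^ Q) +
        u ^ (Q ^ (n + 1) - Q ^ (k + 1)) * qtBinomial Q n k (u ^ Q) := by
  have hs := one_sub_zpow_ne_zero hu (pow_sub_pow_ne_zero hQ k.succ_pos)
  rw [pow_zero] at hs
  rw [qtBinomial_succ_succ, qtFactorialRatio_mul_qtBinomial hQ n k hu,
    ← sub_add_sub_cancel' (Q ^ (k + 1)), zpow_add₀ hu₀]
  field_simp
  ring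

end QTBinomial

section Positivity

variable {F : Type*} [Field F] {u : F} {q : ℕ}

/-- The Laurent polynomials in `u` with natural number coefficients. -/
def nonnegLaurent (u : F) : Subalgebra ℕ F := Algebra.adjoin ℕ {u, u⁻¹}

lemma zpow_mem_nonnegLaurent (u : F) (m : ℤ) : u ^ m ∈ nonnegLaurent u := by
  cases m with
  | ofNat m =>
    rw [Int.ofNat_eq_natCast, zpow_natCast]
    exact pow_mem (Algebra.subset_adjoin (by simp)) m
  | negSucc m =>
    rw [zpow_negSucc, ← inv_pow]
    exact pow_mem (Algebra.subset_adjoin (by simp)) (m + 1)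

lemma nonnegLaurent_zpow_le (u : F) (m : ℤ) : nonnegLaurent (u ^ m) ≤ nonnegLaurent u := by
  refine Algebra.adjoin_le ?_
  rintro x (rfl | rfl)
  · exact zpow_mem_nonnegLaurent u m
  · rw [← zpow_neg]
    exact zpow_mem_nonnegLaurent u (-m)

lemma neg_one_pow_mul_mem_congr {S : Subalgebra ℕ F} {a b : ℕ} {x : F}
    (hx : (-1) ^ a * x ∈ S) (hab : Even b ↔ Even a) : (-1) ^ b * x ∈ S := by
  rwa [neg_one_pow_congr hab]

lemma neg_one_pow_add_mul_mem {S : Subalgebra ℕ F} {a b : ℕ} {x y : F}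
    (hx : (-1) ^ a * x ∈ S) (hy : (-1) ^ b * y ∈ S) : (-1) ^ (a + b) * (x * y) ∈ S := by
  rw [pow_add, mul_mul_mul_comm]
  exact mul_mem hx hy

lemma one_sub_pow_div_one_sub_mem_nonnegLaurent (v : F) (hv : v ≠ 1) (m : ℕ) :
    (1 - v ^ m) / (1 - v) ∈ nonnegLaurent v := by
  rw [← neg_div_neg_eq, neg_sub, neg_sub, ← geom_sum_eq hv]
  exact sum_mem fun i _ ↦ mod_cast zpow_mem_nonnegLaurent v i

lemma neg_one_pow_mul_one_sub_zpow_div_mem_nonnegLaurent (q r : ℕ) {v : F} (hv : v ≠ 1)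
    (hv₀ : v ≠ 0) :
    (-1) ^ r * ((1 - v ^ (-(q : ℤ)) ^ r) / (1 - v)) ∈ nonnegLaurent v := by
  have hgeom := one_sub_pow_div_one_sub_mem_nonnegLaurent v hv (q ^ r)
  rcases r.even_or_odd with hr | hr
  · rwa [hr.neg_one_pow, one_mul, hr.neg_pow, ← Nat.cast_pow, zpow_natCast]
  · convert mul_mem (zpow_mem_nonnegLaurent v (-(q ^ r : ℕ))) hgeom using 1
    rw [hr.neg_one_pow, hr.neg_pow, ← Nat.cast_pow, zpow_neg, zpow_natCast]
    have := sub_ne_zero.2 hv.symm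
    field_simp
    ring

lemma neg_one_pow_mul_qtFactorialRatio_mem_nonnegLaurent (hq : 2 ≤ q) (r k : ℕ)
    (hu : ¬ IsOfFinOrder u) (hu₀ : u ≠ 0) :
    (-1) ^ (r * k) * qtFactorialRatio (-q) r k u ∈ nonnegLaurent u := by
  have hprod : (-1) ^ (r * k) * qtFactorialRatio (-q) r k u = ∏ i ∈ range k,
      (-1) ^ r * ((1 - (u ^ ((-q : ℤ) ^ k - (-q) ^ i)) ^ (-(q : ℤ)) ^ r) /
        (1 - u ^ ((-q : ℤ) ^ k - (-q) ^ i))) := by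
    rw [qtFactorialRatio, qtDescFactorial, qtDescFactorial, prod_mul_distrib, prod_const,
      card_range, ← pow_mul, prod_div_distrib]
    simp only [zpow_comm u]
  rw [hprod]
  refine prod_mem fun i hi ↦ nonnegLaurent_zpow_le u _
    (neg_one_pow_mul_one_sub_zpow_div_mem_nonnegLaurent q r ?_ (zpow_ne_zero _ hu₀))
  rw [Ne, zpow_eq_one_iff_of_not_isOfFinOrder hu]
  exact pow_sub_pow_ne_zero (by simpa using hq) (mem_range.1 hi)

lemma neg_mul_one_sub_zpow_neg_div_one_sub (hq : q ≠ 0) {s : F} (hs : s ≠ 1) (hs₀ : s ≠ 0) :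
    -(s * ((1 - s ^ (-q : ℤ)) / (1 - s))) =
      1 + s ^ (1 - q : ℤ) * ((1 - s ^ (q - 1)) / (1 - s)) := by
  obtain ⟨p, rfl⟩ := Nat.exists_eq_succ_of_ne_zero hq
  have hs' := sub_ne_zero.2 hs.symm
  have hneg : s ^ (-(p + 1 : ℕ) : ℤ) = (s ^ p * s)⁻¹ := by
    rw [zpow_neg, zpow_natCast, pow_succ]
  have hsub : s ^ (1 - (p + 1 : ℕ) : ℤ) = (s ^ p)⁻¹ := by
    rw [← zpow_natCast, ← zpow_neg]; push_cast; ring_nf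
  rw [Nat.succ_eq_add_one, hneg, hsub, Nat.add_sub_cancel]
  field_simp
  ring

lemma exists_neg_mul_qtFactorialRatio_succ_eq (hq : 2 ≤ q) (k : ℕ) (hu : ¬ IsOfFinOrder u)
    (hu₀ : u ≠ 0) :
    ∃ R ∈ nonnegLaurent u, -(u ^ ((-q : ℤ) ^ (k + 1) - 1) * qtFactorialRatio (-q) 1 (k + 1) u) =
      qtFactorialRatio (-q) 1 k (u ^ (-q : ℤ)) * (1 + R) := by
  set s := u ^ ((-q : ℤ) ^ (k + 1) - 1) with hs_def
  have hs : s ≠ 1 := by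
    rw [hs_def, Ne, zpow_eq_one_iff_of_not_isOfFinOrder hu, ← pow_zero (-q : ℤ)]
    exact pow_sub_pow_ne_zero (by simpa using hq) k.succ_pos
  refine ⟨s ^ (1 - q : ℤ) * ((1 - s ^ (q - 1)) / (1 - s)), nonnegLaurent_zpow_le u _
    (mul_mem (zpow_mem_nonnegLaurent s _) (one_sub_pow_div_one_sub_mem_nonnegLaurent s hs _)), ?_⟩
  rw [← neg_mul_one_sub_zpow_neg_div_one_sub (by lia) hs (zpow_ne_zero _ hu₀),
    qtFactorialRatio_one_succ]
  ring

/-- The positivity statement for `(q, t)`-binomials with upper index `n`, over all `u`. The sign is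
the one with which the Laurent polynomial `qtBinomial (-q) n k u` has nonnegative coefficients. -/
def QTBinomialNonneg (F : Type*) [Field F] (q n : ℕ) : Prop :=
  ∀ (k : ℕ) {u : F}, ¬ IsOfFinOrder u → u ≠ 0 →
    (-1) ^ (k * (n + 1)) * qtBinomial (-q) n k u ∈ nonnegLaurent u

namespace QTBinomialNonneg

variable {n k : ℕ}

lemma zpow_mem (h : QTBinomialNonneg F q n) (k : ℕ) (hu : ¬ IsOfFinOrder u) (hu₀ : u ≠ 0) {m : ℤ}
    (hm : m ≠ 0) :
    (-1) ^ (k * (n + 1)) * qtBinomial (-q) n k (u ^ m) ∈ nonnegLaurent u :=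
  nonnegLaurent_zpow_le u m (h k (not_isOfFinOrder_zpow hu hm) (zpow_ne_zero m hu₀))

lemma succ_succ_mem (h : QTBinomialNonneg F q n) (hq : 2 ≤ q) (hnk : Even (n + k))
    (hu : ¬ IsOfFinOrder u) (hu₀ : u ≠ 0) :
    (-1) ^ ((k + 1) * (n + 2)) * qtBinomial (-q) (n + 1) (k + 1) u ∈ nonnegLaurent u := by
  have hB := h.zpow_mem k hu hu₀ (m := -q) (by lia)
  have hFB := neg_one_pow_add_mul_mem
    (neg_one_pow_mul_qtFactorialRatio_mem_nonnegLaurent hq 1 (k + 1) hu hu₀)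
    (h.zpow_mem (k + 1) hu hu₀ (m := -q) (by lia))
  have hs := zpow_mem_nonnegLaurent u ((-q : ℤ) ^ (k + 1) - 1)
  have hsFB := neg_one_pow_add_mul_mem (a := 0) (by simpa using hs) hFB
  rw [qtBinomial_pascal (by simpa using hq) n k hu hu₀, mul_add]
  refine add_mem (neg_one_pow_mul_mem_congr hB ?_) (neg_one_pow_mul_mem_congr hsFB ?_) <;>
    grind

lemma succ_sub_mem (h : QTBinomialNonneg F q n) (hq : 2 ≤ q) (hnk : Even (n + k))
    (hu : ¬ IsOfFinOrder u) (hu₀ : u ≠ 0) :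
    (-1) ^ (k + 1) * (qtBinomial (-q) (n + 1) k u -
      qtFactorialRatio (-q) 1 k u * qtBinomial (-q) n k (u ^ (-q : ℤ))) ∈ nonnegLaurent u := by
  cases k with
  | zero => simp [qtBinomial, qtFactorialRatio, qtDescFactorial]
  | succ k =>
    rw [qtBinomial_pascal_dual (by simpa using hq) n k hu hu₀, add_sub_cancel_left]
    refine neg_one_pow_mul_mem_congr (neg_one_pow_add_mul_mem (a := 0)
      (by simpa using zpow_mem_nonnegLaurent u _) (h.zpow_mem k hu hu₀ (m := -q) (by lia))) ?_
    grind

-- Two applications of `qtBinomial_pascal` leave one summand of the wrong sign, which is absorbed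
-- in the difference of `succ_sub_mem`.
lemma succ_succ_succ_mem (h : QTBinomialNonneg F q n) (hq : 2 ≤ q) (hnk : Even (n + k))
    (hu : ¬ IsOfFinOrder u) (hu₀ : u ≠ 0) :
    (-1) ^ ((k + 1) * (n + 3)) * qtBinomial (-q) (n + 2) (k + 1) u ∈ nonnegLaurent u := by
  have hQ : 2 ≤ |(-q : ℤ)| := by simpa using hq
  have hQ₀ : (-q : ℤ) ≠ 0 := by lia
  set v := u ^ (-q : ℤ)
  have hv : ¬ IsOfFinOrder v := not_isOfFinOrder_zpow hu hQ₀
  have hv₀ : v ≠ 0 := zpow_ne_zero _ hu₀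
  have hvu : nonnegLaurent v ≤ nonnegLaurent u := nonnegLaurent_zpow_le u _
  set s := u ^ ((-q : ℤ) ^ (k + 1) - 1)
  set t := v ^ ((-q : ℤ) ^ (k + 1) - 1)
  have hst : s * t ∈ nonnegLaurent u :=
    mul_mem (zpow_mem_nonnegLaurent u _) (hvu (zpow_mem_nonnegLaurent v _))
  obtain ⟨R, hR, hRF⟩ := exists_neg_mul_qtFactorialRatio_succ_eq hq k hu hu₀
  have hdiff := hvu (h.succ_sub_mem hq hnk hv hv₀)
  have hRB := neg_one_pow_add_mul_mem
    (hvu (neg_one_pow_mul_qtFactorialRatio_mem_nonnegLaurent hq 1 k hv hv₀))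
    (neg_one_pow_add_mul_mem (a := 0) (by simpa using hR) (hvu (h.zpow_mem k hv hv₀ hQ₀)))
  have hFFB := neg_one_pow_add_mul_mem (a := 0) (by simpa using hst) (neg_one_pow_add_mul_mem
    (neg_one_pow_mul_qtFactorialRatio_mem_nonnegLaurent hq 1 (k + 1) hu hu₀)
    (neg_one_pow_add_mul_mem
      (hvu (neg_one_pow_mul_qtFactorialRatio_mem_nonnegLaurent hq 1 (k + 1) hv hv₀))
      (hvu (h.zpow_mem (k + 1) hv hv₀ hQ₀))))
  have hsplit : qtBinomial (-q) (n + 2) (k + 1) u =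
      (qtBinomial (-q) (n + 1) k v -
        qtFactorialRatio (-q) 1 k v * qtBinomial (-q) n k (v ^ (-q : ℤ)))
      + (-1) * (qtFactorialRatio (-q) 1 k v * (R * qtBinomial (-q) n k (v ^ (-q : ℤ))))
      + s * t * (qtFactorialRatio (-q) 1 (k + 1) u *
        (qtFactorialRatio (-q) 1 (k + 1) v * qtBinomial (-q) n (k + 1) (v ^ (-q : ℤ)))) := by
    rw [qtBinomial_pascal hQ (n + 1) k hu hu₀, qtBinomial_pascal hQ n k hv hv₀]
    linear_combination (-qtBinomial (-q) n k (v ^ (-q : ℤ))) * hRF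
  rw [hsplit, mul_add, mul_add, ← mul_assoc _ (-1) (_ * _), ← pow_succ]
  refine add_mem (add_mem (neg_one_pow_mul_mem_congr hdiff ?_) (neg_one_pow_mul_mem_congr hRB ?_))
    (neg_one_pow_mul_mem_congr hFFB ?_) <;> grind

end QTBinomialNonneg

theorem qtBinomialNonneg (F : Type*) [Field F] (hq : 2 ≤ q) (n : ℕ) : QTBinomialNonneg F q n := by
  induction n using Nat.strong_induction_on with
  | _ n ih =>
  intro k u hu hu₀
  match n, k with
  | n, 0 => simp [qtBinomial, qtDescFactorial]
  | 0, k + 1 => simp [qtBinomial, qtDescFactorial_eq_zero_of_lt]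
  | n + 1, k + 1 =>
    rcases Nat.even_or_odd (n + k) with hnk | hnk
    · exact (ih n (by lia)).succ_succ_mem hq hnk hu hu₀
    · match n, k with
      | 0, k => simp [qtBinomial, qtDescFactorial_eq_zero_of_lt _ (show 1 < k + 1 by grind)]
      | n + 1, k => exact (ih n (by lia)).succ_succ_succ_mem hq (by grind) hu hu₀

end Positivity

section LaurentToPolynomial

lemma exists_mul_pow_eq_eval₂ {F : Type*} [Field F] {u f : F} (hu : u ≠ 0)
    (hf : f ∈ nonnegLaurent u) :
    ∃ (e : ℕ) (P : ℕ[X]), f * u ^ e = P.eval₂ (Nat.castRingHom F) u := by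
  induction hf using Algebra.adjoin_induction with
  | mem x hx =>
    obtain rfl | rfl := hx
    · exact ⟨0, X, by simp⟩
    · exact ⟨1, 1, by simp [hu]⟩
  | algebraMap m => exact ⟨0, C m, by simp⟩
  | add x y _ _ hx hy =>
    obtain ⟨⟨d, P, hP⟩, ⟨e, R, hR⟩⟩ := hx, hy
    refine ⟨d + e, P * X ^ e + R * X ^ d, ?_⟩
    simp only [eval₂_add, eval₂_mul, eval₂_X_pow, ← hP, ← hR]
    ring
  | mul x y _ _ hx hy =>
    obtain ⟨⟨d, P, hP⟩, ⟨e, R, hR⟩⟩ := hx, hy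
    refine ⟨d + e, P * R, ?_⟩
    rw [eval₂_mul, ← hP, ← hR]
    ring

-- The `ℕ`-algebra structure of `RatFunc ℚ` is not definitionally the one of a general semiring.
lemma aeval_eq_eval₂ {A : Type*} [Semiring A] [Algebra ℕ A] (x : A) (P : ℕ[X]) :
    aeval x P = P.eval₂ (Nat.castRingHom A) x := by
  rw [aeval_def, Subsingleton.elim (algebraMap ℕ A) (Nat.castRingHom A)]

lemma aeval_X_eq_algebraMap (P : ℕ[X]) :
    aeval (RatFunc.X : RatFunc ℚ) P = algebraMap ℚ[X] (RatFunc ℚ) (P.map (Nat.castRingHom ℚ)) := by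
  induction P using Polynomial.induction_on' with
  | add P R hP hR => simp [hP, hR]
  | monomial n a => simp [← C_mul_X_pow_eq_monomial]

lemma X_pow_dvd_of_valuation_aeval_le {P : ℕ[X]} {e : ℕ}
    (h : (idealX ℚ).valuation (RatFunc ℚ) (aeval RatFunc.X P) ≤ WithZero.exp (-(e : ℤ))) :
    X ^ e ∣ P := by
  rw [aeval_X_eq_algebraMap, IsDedekindDomain.HeightOneSpectrum.valuation_of_algebraMap,
    IsDedekindDomain.HeightOneSpectrum.intValuation_le_pow_iff_mem, idealX_span,
    Ideal.span_singleton_pow, Ideal.mem_span_singleton, X_pow_dvd_iff] at h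
  exact X_pow_dvd_iff.2 fun d hd ↦ by simpa using h d hd

lemma exists_aeval_eq_of_mem_nonnegLaurent {f : RatFunc ℚ} (hf : f ∈ nonnegLaurent RatFunc.X)
    (hv : (idealX ℚ).valuation (RatFunc ℚ) f ≤ 1) : ∃ P : ℕ[X], aeval RatFunc.X P = f := by
  obtain ⟨e, P, hP⟩ := exists_mul_pow_eq_eval₂ RatFunc.X_ne_zero hf
  rw [← aeval_eq_eval₂] at hP
  have hdvd : X ^ e ∣ P := by
    refine X_pow_dvd_of_valuation_aeval_le ?_
    rw [← hP, map_mul, map_pow, valuation_X_eq_neg_one, ← WithZero.exp_nsmul, nsmul_eq_mul,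
      mul_neg_one]
    exact mul_le_of_le_one_left' hv
  obtain ⟨R, rfl⟩ := hdvd
  refine ⟨R, mul_right_cancel₀ (pow_ne_zero e RatFunc.X_ne_zero) ?_⟩
  rw [hP, map_mul, map_pow, aeval_X, mul_comm]

lemma valuation_one_sub_X_zpow {m : ℤ} (hm : 0 < m) :
    (idealX ℚ).valuation (RatFunc ℚ) (1 - RatFunc.X ^ m) = 1 := by
  refine Valuation.map_one_sub_of_lt _ ?_
  rw [map_zpow₀, valuation_X_eq_neg_one, ← WithZero.exp_zsmul, ← WithZero.exp_zero,
    WithZero.exp_lt_exp]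
  simpa

lemma not_isOfFinOrder_X : ¬ IsOfFinOrder (RatFunc.X : RatFunc ℚ) := by
  rw [isOfFinOrder_iff_pow_eq_one]
  rintro ⟨m, hm, h⟩
  have hval := valuation_one_sub_X_zpow (mod_cast hm : (0 : ℤ) < m)
  rw [zpow_natCast, h, sub_self, map_zero] at hval
  exact zero_ne_one hval

end LaurentToPolynomial

section SievingFunction

variable {q n k : ℕ}

/-- The closed form `X(t)` of the sieving function, as a product of a ratio of `(q, t)`-factorials
and a `(q, t)`-binomial coefficient, with `Q = -q` and `u = t⁻¹`. -/
def sievingProduct {F : Type*} [Field F] (Q : ℤ) (n k : ℕ) (u : F) : F :=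
  qtFactorialRatio Q (n - k) k u * qtBinomial Q n k u

lemma sievingProduct_mem_nonnegLaurent {F : Type*} [Field F] {u : F} (hq : 2 ≤ q) (hk : k ≤ n)
    (hu : ¬ IsOfFinOrder u) (hu₀ : u ≠ 0) : sievingProduct (-q) n k u ∈ nonnegLaurent u := by
  have hmem := neg_one_pow_add_mul_mem
    (neg_one_pow_mul_qtFactorialRatio_mem_nonnegLaurent hq (n - k) k hu hu₀)
    (qtBinomialNonneg F hq n k hu hu₀)
  have hmem' := neg_one_pow_mul_mem_congr (b := 0) hmem (by grind)
  rwa [pow_zero, one_mul] at hmem'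

lemma zpow_sum₀ {G₀ ι : Type*} [CommGroupWithZero G₀] {a : G₀} (ha : a ≠ 0) (s : Finset ι)
    (f : ι → ℤ) : a ^ ∑ i ∈ s, f i = ∏ i ∈ s, a ^ f i := by
  classical
  induction s using Finset.induction_on with
  | empty => simp
  | insert i s hi ih => rw [sum_insert hi, prod_insert hi, zpow_add₀ ha, ih]

lemma sq_prod_denominators_eq {F : Type*} [Field F] {t : F} (ht : t ≠ 0) (q k : ℕ) :
    (∏ i ∈ range k, (1 - t ^ ((q : ℤ) ^ k - (-1) ^ k * (-(q : ℤ)) ^ i))) ^ 2 =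
      t ^ sievingExponent q k * qtDescFactorial (-q) k k t⁻¹ ^ 2 := by
  rw [sievingExponent, qtDescFactorial]
  rcases k.even_or_odd with hk | hk
  · rw [if_neg (Nat.not_odd_iff_even.2 hk), mul_comm 2, zpow_mul, zpow_ofNat, ← mul_pow,
      zpow_sum₀ ht, ← prod_mul_distrib, ← prod_pow, ← prod_pow]
    refine prod_congr rfl fun i _ ↦ ?_
    rw [hk.neg_one_pow, hk.neg_pow, inv_zpow, one_mul, mul_one_sub,
      mul_inv_cancel₀ (zpow_ne_zero _ ht), sub_sq_comm]
  · rw [if_pos hk, zpow_zero, one_mul, hk.neg_one_pow, hk.neg_pow]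
    simp only [inv_zpow']
    ring_nf

lemma sievingFunction_eq_sievingProduct (hn : Odd n) (hk : k ≤ n) :
    sievingFunction q n k = sievingProduct (-q) n k RatFunc.X⁻¹ := by
  have hnum₁ : ∏ i ∈ range k, (1 - (RatFunc.X : RatFunc ℚ) ^
      ((q : ℤ) ^ n + (-(q : ℤ)) ^ (n - k + i))) =
      qtDescFactorial (-q) k k (RatFunc.X⁻¹ ^ (-q : ℤ) ^ (n - k)) := by
    refine prod_congr rfl fun i _ ↦ ?_
    rw [← zpow_mul, inv_zpow', mul_sub, ← pow_add, ← pow_add, Nat.sub_add_cancel hk, hn.neg_pow]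
    ring_nf
  have hnum₂ : ∏ i ∈ range k, (1 - (RatFunc.X : RatFunc ℚ) ^ ((q : ℤ) ^ n + (-(q : ℤ)) ^ i)) =
      qtDescFactorial (-q) n k RatFunc.X⁻¹ := by
    refine prod_congr rfl fun i _ ↦ ?_
    rw [inv_zpow', hn.neg_pow]
    ring_nf
  rw [sievingFunction, prod_div_distrib, prod_div_distrib, hnum₁, hnum₂, mul_assoc,
    div_mul_div_comm, ← sq, sq_prod_denominators_eq RatFunc.X_ne_zero, ← mul_div_assoc,
    mul_div_mul_left _ _ (zpow_ne_zero _ RatFunc.X_ne_zero), sq, ← div_mul_div_comm]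
  rfl

lemma abs_neg_pow_lt (hq : 2 ≤ q) {i : ℕ} (hi : i < k) : |(-(q : ℤ)) ^ i| < (q : ℤ) ^ k := by
  rw [abs_pow, abs_neg, Nat.abs_cast]
  exact pow_lt_pow_right₀ (by exact_mod_cast hq) hi

lemma numeratorExponent_pos (hq : 2 ≤ q) {i : ℕ} (hi : i < n) :
    0 < (q : ℤ) ^ n + (-(q : ℤ)) ^ i := by
  linarith [abs_lt.1 (abs_neg_pow_lt hq hi)]

lemma denominatorExponent_pos (hq : 2 ≤ q) {i : ℕ} (hi : i < k) :
    0 < (q : ℤ) ^ k - (-1) ^ k * (-(q : ℤ)) ^ i := by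
  refine sub_pos.2 ((le_abs_self _).trans_lt ?_)
  simpa [abs_mul] using abs_neg_pow_lt hq hi

lemma sievingExponent_nonneg (hq : 2 ≤ q) : 0 ≤ sievingExponent q k := by
  rw [sievingExponent]
  split_ifs
  · exact le_rfl
  · exact mul_nonneg zero_le_two (sum_nonneg fun i hi ↦
      sub_nonneg.2 (abs_lt.1 (abs_neg_pow_lt hq (mem_range.1 hi))).2.le)

lemma valuation_sievingFunction_le_one (hq : 2 ≤ q) (hk : k ≤ n) :
    (idealX ℚ).valuation (RatFunc ℚ) (sievingFunction q n k) ≤ 1 := by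
  have hprod : ∀ a b : ℕ → ℤ, (∀ i < k, 0 < a i) → (∀ i < k, 0 < b i) →
      (idealX ℚ).valuation (RatFunc ℚ)
        (∏ i ∈ range k, (1 - RatFunc.X ^ a i) / (1 - RatFunc.X ^ b i)) = 1 := by
    intro a b ha hb
    rw [map_prod]
    refine prod_eq_one fun i hi ↦ ?_
    have hi := mem_range.1 hi
    rw [map_div₀, valuation_one_sub_X_zpow (ha i hi), valuation_one_sub_X_zpow (hb i hi), div_one]
  have hden : ∀ i < k, 0 < (q : ℤ) ^ k - (-1) ^ k * (-(q : ℤ)) ^ i :=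
    fun i ↦ denominatorExponent_pos hq
  rw [sievingFunction, map_mul, map_mul,
    hprod _ _ (fun i hi ↦ numeratorExponent_pos hq (by lia)) hden,
    hprod _ _ (fun i hi ↦ numeratorExponent_pos hq (by lia)) hden, mul_one, mul_one, map_zpow₀,
    valuation_X_eq_neg_one, ← WithZero.exp_zsmul, ← WithZero.exp_zero, WithZero.exp_le_exp]
  simpa using sievingExponent_nonneg hq

theorem exists_aeval_eq_sievingFunction (hq : 2 ≤ q) (hn : Odd n) (hk : k ≤ n) :
    ∃ P : ℕ[X], aeval (RatFunc.X : RatFunc ℚ) P = sievingFunction q n k := by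
  refine exists_aeval_eq_of_mem_nonnegLaurent ?_ (valuation_sievingFunction_le_one hq hk)
  have hX : ¬ IsOfFinOrder (RatFunc.X⁻¹ : RatFunc ℚ) := by
    simpa using not_isOfFinOrder_zpow not_isOfFinOrder_X (by simp : (-1 : ℤ) ≠ 0)
  have hle : nonnegLaurent (RatFunc.X⁻¹ : RatFunc ℚ) ≤ nonnegLaurent RatFunc.X := by
    simpa using nonnegLaurent_zpow_le (RatFunc.X : RatFunc ℚ) (-1)
  rw [sievingFunction_eq_sievingProduct hn hk]
  exact hle (sievingProduct_mem_nonnegLaurent hq hk hX (inv_ne_zero RatFunc.X_ne_zero))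

end SievingFunction

section RootsOfUnity

open Filter Topology

section Limits

variable {𝕜 : Type*} [NontriviallyNormedField 𝕜] {ω : 𝕜}

lemma tendsto_zpow_sub_one_div (hω : ω ≠ 0) {a : ℤ} (ha : ω ^ a = 1) :
    Tendsto (fun u ↦ (u ^ a - 1) / (u - ω)) (𝓝[≠] ω) (𝓝 (a * ω⁻¹)) := by
  have hslope := (hasDerivAt_zpow a ω (.inl hω)).tendsto_slope
  rw [zpow_sub_one₀ hω, ha, one_mul] at hslope
  simpa only [slope_fun_def_field, ha] using hslope

lemma tendsto_one_sub_zpow_div_of_eq_one [CharZero 𝕜] (hω : ω ≠ 0) {a b : ℤ} (hb₀ : b ≠ 0)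
    (ha : ω ^ a = 1) (hb : ω ^ b = 1) :
    Tendsto (fun u ↦ (1 - u ^ a) / (1 - u ^ b)) (𝓝[≠] ω) (𝓝 (a / b : 𝕜)) := by
  have hlim := (tendsto_zpow_sub_one_div hω ha).div (tendsto_zpow_sub_one_div hω hb)
    (mul_ne_zero (Int.cast_ne_zero.2 hb₀) (inv_ne_zero hω))
  rw [mul_div_mul_right _ _ (inv_ne_zero hω)] at hlim
  refine hlim.congr' ?_
  filter_upwards [self_mem_nhdsWithin] with u hu
  rw [Pi.div_apply, div_div_div_cancel_right₀ (sub_ne_zero.2 hu), ← neg_div_neg_eq, neg_sub,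
    neg_sub]

lemma tendsto_one_sub_zpow_div_of_ne_one (hω : ω ≠ 0) (a : ℤ) {b : ℤ} (hb : ω ^ b ≠ 1) :
    Tendsto (fun u ↦ (1 - u ^ a) / (1 - u ^ b)) (𝓝[≠] ω) (𝓝 ((1 - ω ^ a) / (1 - ω ^ b))) := by
  have hcont : ∀ c : ℤ, Tendsto (fun u ↦ 1 - u ^ c) (𝓝[≠] ω) (𝓝 (1 - ω ^ c)) := fun c ↦
    tendsto_nhdsWithin_of_tendsto_nhds ((continuousAt_zpow₀ ω c (.inl hω)).const_sub 1)
  exact (hcont a).div (hcont b) (sub_ne_zero.2 hb.symm)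

lemma exists_tendsto_one_sub_zpow_div [CharZero 𝕜] (hω : ω ≠ 0) {a b : ℤ} (hb₀ : b ≠ 0)
    (hab : ω ^ b = 1 → ω ^ a = 1) :
    ∃ l, Tendsto (fun u ↦ (1 - u ^ a) / (1 - u ^ b)) (𝓝[≠] ω) (𝓝 l) := by
  by_cases hb : ω ^ b = 1
  · exact ⟨_, tendsto_one_sub_zpow_div_of_eq_one hω hb₀ (hab hb) hb⟩
  · exact ⟨_, tendsto_one_sub_zpow_div_of_ne_one hω a hb⟩

end Limits

section MultiplicativeOrder

variable {G₀ : Type*} [GroupWithZero G₀] {ω : G₀} {Q : ℤ} {n : ℕ}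

lemma zpow_eq_zpow_iff_intCast_zmod (hω : ω ≠ 0) (a b : ℤ) :
    ω ^ a = ω ^ b ↔ (a : ZMod (orderOf ω)) = b := by
  rw [← div_eq_one_iff_eq (zpow_ne_zero b hω), ← zpow_sub₀ hω, zpow_eq_one_iff_orderOf_dvd,
    ← ZMod.intCast_zmod_eq_zero_iff_dvd, Int.cast_sub, sub_eq_zero]

lemma pow_eq_pow_iff_modEq_of_pow_eq_one {M : Type*} [Monoid M] {x : M} (hn : n ≠ 0)
    (hx : x ^ n = 1) (i j : ℕ) : x ^ i = x ^ j ↔ i ≡ j [MOD orderOf x] := by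
  lift x to Mˣ using IsUnit.of_pow_eq_one hx hn
  rw [orderOf_units, ← pow_eq_pow_iff_modEq]
  norm_cast

lemma zpow_pow_sub_pow_eq_one_iff (hn : n ≠ 0)
    (hQ : (Q : ZMod (orderOf ω)) ^ n = 1) (k i : ℕ) :
    ω ^ (Q ^ k - Q ^ i) = 1 ↔ k ≡ i [MOD orderOf (Q : ZMod (orderOf ω))] := by
  rw [zpow_eq_one_iff_orderOf_dvd, ← ZMod.intCast_zmod_eq_zero_iff_dvd, Int.cast_sub, sub_eq_zero,
    Int.cast_pow, Int.cast_pow, pow_eq_pow_iff_modEq_of_pow_eq_one hn hQ]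

end MultiplicativeOrder

lemma prod_range_mul_ite_dvd {M : Type*} [CommMonoid M] {m : ℕ} (hm : 0 < m) (f : ℕ → M) (r : ℕ) :
    ∏ i ∈ range (m * r), (if m ∣ i then f i else 1) = ∏ j ∈ range r, f (m * j) := by
  rw [← prod_filter]
  refine (prod_nbij (m * ·) ?_ ?_ ?_ fun _ _ ↦ rfl).symm
  · intro j hj
    simpa [hm] using hj
  · exact fun i _ j _ ↦ Nat.eq_of_mul_eq_mul_left hm
  · rintro i hi
    obtain ⟨hi, j, rfl⟩ := mem_filter.1 hi
    exact ⟨j, by simpa [hm] using hi, rfl⟩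

section SievingProductLimits

variable {𝕜 : Type*} [NontriviallyNormedField 𝕜] [CharZero 𝕜] {ω : 𝕜} {Q : ℤ} {n k : ℕ}

lemma qtFactorialRatio_eq_prod {F : Type*} [Field F] (Q : ℤ) (r k : ℕ) (u : F) :
    qtFactorialRatio Q r k u =
      ∏ i ∈ range k, (1 - u ^ (Q ^ r * (Q ^ k - Q ^ i))) / (1 - u ^ (Q ^ k - Q ^ i)) := by
  simp only [qtFactorialRatio, qtDescFactorial, zpow_mul, prod_div_distrib]

lemma qtBinomial_eq_prod {F : Type*} [Field F] (Q : ℤ) (n k : ℕ) (u : F) :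
    qtBinomial Q n k u =
      ∏ i ∈ range k, (1 - u ^ (Q ^ n - Q ^ i)) / (1 - u ^ (Q ^ k - Q ^ i)) := by
  simp only [qtBinomial, qtDescFactorial, prod_div_distrib]

lemma qtBinomial_succ_eq_prod_reflect {F : Type*} [Field F] (Q : ℤ) (n k : ℕ) (u : F) :
    qtBinomial Q n (k + 1) u =
      (∏ i ∈ range k,
        (1 - u ^ (Q ^ n - Q ^ (i + 1))) / (1 - u ^ (Q ^ (k + 1) - Q ^ (k - i)))) *
        ((1 - u ^ (Q ^ n - Q ^ 0)) / (1 - u ^ (Q ^ (k + 1) - Q ^ 0))) := by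
  rw [qtBinomial, qtDescFactorial, qtDescFactorial, prod_range_succ', prod_range_succ' _ k,
    ← prod_range_reflect (fun i ↦ 1 - u ^ (Q ^ (k + 1) - Q ^ (i + 1))) k, mul_div_mul_comm,
    ← prod_div_distrib]
  congr 1
  refine prod_congr rfl fun i hi ↦ ?_
  rw [show k - 1 - i + 1 = k - i by have := mem_range.1 hi; lia]

lemma exists_tendsto_qtFactorialRatio (hQ : 2 ≤ |Q|) (r k : ℕ) (hω : ω ≠ 0) :
    ∃ l, Tendsto (qtFactorialRatio Q r k) (𝓝[≠] ω) (𝓝 l) := by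
  have hfactor : ∀ i ∈ range k, ∃ l, Tendsto
      (fun u ↦ (1 - u ^ (Q ^ r * (Q ^ k - Q ^ i))) / (1 - u ^ (Q ^ k - Q ^ i))) (𝓝[≠] ω) (𝓝 l) :=
    fun i hi ↦ exists_tendsto_one_sub_zpow_div hω (pow_sub_pow_ne_zero hQ (mem_range.1 hi))
      fun h ↦ by rw [mul_comm, zpow_mul, h, one_zpow]
  choose! l hl using hfactor
  exact ⟨_, (tendsto_finsetProd _ hl).congr fun u ↦ (qtFactorialRatio_eq_prod Q r k u).symm⟩

theorem tendsto_sievingProduct_of_not_dvd (hQ : 2 ≤ |Q|) (hn : n ≠ 0) (hω : ω ≠ 0)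
    (hQn : (Q : ZMod (orderOf ω)) ^ n = 1) (hk : ¬ orderOf (Q : ZMod (orderOf ω)) ∣ k) :
    Tendsto (sievingProduct Q n k) (𝓝[≠] ω) (𝓝 0) := by
  obtain ⟨k, rfl⟩ := Nat.exists_eq_succ_of_ne_zero (show k ≠ 0 by rintro rfl; simp at hk)
  have hmn : orderOf (Q : ZMod (orderOf ω)) ∣ n := orderOf_dvd_of_pow_eq_one hQn
  have hfirst : Tendsto (fun u ↦ (1 - u ^ (Q ^ n - Q ^ 0)) / (1 - u ^ (Q ^ (k + 1) - Q ^ 0)))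
      (𝓝[≠] ω) (𝓝 0) := by
    have hne : ω ^ (Q ^ (k + 1) - Q ^ 0) ≠ 1 := by
      rwa [Ne, zpow_pow_sub_pow_eq_one_iff hn hQn, Nat.modEq_zero_iff_dvd]
    have heq : ω ^ (Q ^ n - Q ^ 0) = 1 := by
      rwa [zpow_pow_sub_pow_eq_one_iff hn hQn, Nat.modEq_zero_iff_dvd]
    have hlim := tendsto_one_sub_zpow_div_of_ne_one hω (Q ^ n - Q ^ 0) hne
    rwa [heq, sub_self, zero_div] at hlim
  have hrest : ∀ i ∈ range k, ∃ l, Tendsto (fun u ↦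
      (1 - u ^ (Q ^ n - Q ^ (i + 1))) / (1 - u ^ (Q ^ (k + 1) - Q ^ (k - i)))) (𝓝[≠] ω) (𝓝 l) := by
    refine fun i hi ↦ exists_tendsto_one_sub_zpow_div hω (pow_sub_pow_ne_zero hQ (by lia)) ?_
    have hki : k + 1 = k - i + (i + 1) := by have := mem_range.1 hi; lia
    rw [zpow_pow_sub_pow_eq_one_iff hn hQn, zpow_pow_sub_pow_eq_one_iff hn hQn, hki]
    intro h
    have hi_dvd := (Nat.modEq_iff_dvd' (Nat.le_add_right _ _)).1 h.symm
    rw [Nat.add_sub_cancel_left] at hi_dvd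
    exact (Nat.modEq_zero_iff_dvd.2 hmn).trans (Nat.modEq_zero_iff_dvd.2 hi_dvd).symm
  choose! l hl using hrest
  obtain ⟨c, hc⟩ := exists_tendsto_qtFactorialRatio hQ (n - (k + 1)) (k + 1) hω
  have hlim := hc.mul ((tendsto_finsetProd _ hl).mul hfirst)
  simp only [mul_zero] at hlim
  exact hlim.congr fun u ↦ by rw [sievingProduct, qtBinomial_succ_eq_prod_reflect]

lemma tendsto_sievingFactor (hQ : 2 ≤ |Q|) (hn : n ≠ 0) (hω : ω ≠ 0)
    (hQn : (Q : ZMod (orderOf ω)) ^ n = 1) (hk : orderOf (Q : ZMod (orderOf ω)) ∣ k) {l i : ℕ}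
    (hl : orderOf (Q : ZMod (orderOf ω)) ∣ l) (hi : i < k) :
    Tendsto (fun u ↦ (1 - u ^ (Q ^ l * (Q ^ k - Q ^ i))) / (1 - u ^ (Q ^ k - Q ^ i)) *
        ((1 - u ^ (Q ^ n - Q ^ i)) / (1 - u ^ (Q ^ k - Q ^ i)))) (𝓝[≠] ω)
      (𝓝 (if orderOf (Q : ZMod (orderOf ω)) ∣ i then
        (Q ^ l * (Q ^ n - Q ^ i) / (Q ^ k - Q ^ i) : 𝕜) else 1)) := by
  have hk₀ := pow_sub_pow_ne_zero hQ hi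
  have hnum₁ : ω ^ (Q ^ l * (Q ^ k - Q ^ i)) = ω ^ (Q ^ k - Q ^ i) := by
    rw [zpow_eq_zpow_iff_intCast_zmod hω, Int.cast_mul, Int.cast_pow,
      orderOf_dvd_iff_pow_eq_one.1 hl, one_mul]
  have hnum₂ : ω ^ (Q ^ n - Q ^ i) = ω ^ (Q ^ k - Q ^ i) := by
    rw [zpow_eq_zpow_iff_intCast_zmod hω]
    push_cast
    rw [hQn, orderOf_dvd_iff_pow_eq_one.1 hk]
  have hden : ω ^ (Q ^ k - Q ^ i) = 1 ↔ orderOf (Q : ZMod (orderOf ω)) ∣ i := by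
    rw [zpow_pow_sub_pow_eq_one_iff hn hQn, ← Nat.modEq_zero_iff_dvd]
    exact ⟨fun h ↦ h.symm.trans (Nat.modEq_zero_iff_dvd.2 hk),
      fun h ↦ (Nat.modEq_zero_iff_dvd.2 hk).trans h.symm⟩
  split_ifs with hdvd
  · have h₁ := hden.2 hdvd
    have hne : (Q ^ k - Q ^ i : 𝕜) ≠ 0 := mod_cast hk₀
    convert (tendsto_one_sub_zpow_div_of_eq_one hω hk₀ (hnum₁.trans h₁) h₁).mul
      (tendsto_one_sub_zpow_div_of_eq_one hω hk₀ (hnum₂.trans h₁) h₁) using 2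
    push_cast
    field_simp
  · have h₁ : ω ^ (Q ^ k - Q ^ i) ≠ 1 := mt hden.1 hdvd
    simpa only [hnum₁, hnum₂, div_self (sub_ne_zero.2 h₁.symm), one_mul] using
      (tendsto_one_sub_zpow_div_of_ne_one hω (Q ^ l * (Q ^ k - Q ^ i)) h₁).mul
        (tendsto_one_sub_zpow_div_of_ne_one hω (Q ^ n - Q ^ i) h₁)

theorem tendsto_sievingProduct_mul (hQ : 2 ≤ |Q|) (hn : n ≠ 0) (hω : ω ≠ 0)
    (hQn : (Q : ZMod (orderOf ω)) ^ n = 1) {m r : ℕ} (hm : orderOf (Q : ZMod (orderOf ω)) = m) :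
    Tendsto (sievingProduct Q n (m * r)) (𝓝[≠] ω) (𝓝 (∏ j ∈ range r,
      (Q ^ (n - m * r) * (Q ^ n - Q ^ (m * j)) / (Q ^ (m * r) - Q ^ (m * j)) : 𝕜))) := by
  have hm₀ : 0 < m := hm ▸ orderOf_pos_iff.2 (isOfFinOrder_iff_pow_eq_one.2 ⟨n, by lia, hQn⟩)
  have hmn : m ∣ n := hm ▸ orderOf_dvd_of_pow_eq_one hQn
  have hlim := tendsto_finsetProd (range (m * r)) fun i hi ↦
    tendsto_sievingFactor (𝕜 := 𝕜) hQ hn hω hQn (hm ▸ dvd_mul_right m r)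
      (hm ▸ Nat.dvd_sub hmn (dvd_mul_right m r)) (mem_range.1 hi)
  rw [hm, prod_range_mul_ite_dvd hm₀] at hlim
  exact hlim.congr fun u ↦ by
    rw [prod_mul_distrib, sievingProduct, qtFactorialRatio_eq_prod, qtBinomial_eq_prod]

end SievingProductLimits

section SpecializationAtTranscendentals

variable {q n k : ℕ} {ω : ℂ} {P : ℕ[X]}

lemma exists_ringHom_ratFunc_X_eq {z : ℂ} (hz : Transcendental ℚ z) :
    ∃ φ : RatFunc ℚ →+* ℂ, φ RatFunc.X = z :=
  ⟨IsFractionRing.lift (g := (aeval z : ℚ[X] →ₐ[ℚ] ℂ).toRingHom)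
    (transcendental_iff_injective.1 hz), by
    rw [← RatFunc.algebraMap_X, IsFractionRing.lift_algebraMap]
    exact aeval_X z⟩

lemma map_sievingProduct {F E : Type*} [Field F] [Field E] (φ : F →+* E) (Q : ℤ) (n k : ℕ) (u : F) :
    φ (sievingProduct Q n k u) = sievingProduct Q n k (φ u) := by
  simp only [sievingProduct, qtFactorialRatio, qtBinomial, qtDescFactorial, map_mul, map_div₀,
    map_prod, map_sub, map_one, map_zpow₀]

lemma aeval_eq_sievingProduct_of_transcendental (hn : Odd n) (hk : k ≤ n)
    (hP : aeval (RatFunc.X : RatFunc ℚ) P = sievingFunction q n k) {z : ℂ}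
    (hz : Transcendental ℚ z) : aeval z P = sievingProduct (-q) n k z⁻¹ := by
  obtain ⟨φ, rfl⟩ := exists_ringHom_ratFunc_X_eq hz
  rw [← map_inv₀, ← map_sievingProduct, ← sievingFunction_eq_sievingProduct hn hk, ← hP,
    aeval_eq_eval₂, aeval_eq_eval₂, hom_eval₂]
  congr 1
  exact Subsingleton.elim _ _

lemma dense_transcendental : Dense {z : ℂ | Transcendental ℚ z} :=
  (Algebraic.countable ℚ ℂ).dense_compl ℝ

theorem aeval_eq_of_tendsto_sievingProduct (hn : Odd n) (hk : k ≤ n)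
    (hP : aeval (RatFunc.X : RatFunc ℚ) P = sievingFunction q n k) (hω : IsAlgebraic ℚ ω)
    (hω₀ : ω ≠ 0) {c : ℂ} (hc : Tendsto (sievingProduct (-q) n k) (𝓝[≠] ω⁻¹) (𝓝 c)) :
    aeval ω P = c := by
  have : (𝓝[{z | Transcendental ℚ z}] ω).NeBot :=
    mem_closure_iff_nhdsWithin_neBot.1 (dense_transcendental ω)
  have hinv : Tendsto (·⁻¹) (𝓝[{z | Transcendental ℚ z}] ω) (𝓝[≠] ω⁻¹) :=
    tendsto_nhdsWithin_iff.2 ⟨(tendsto_inv₀ hω₀).mono_left nhdsWithin_le_nhds, by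
      filter_upwards [self_mem_nhdsWithin] with z hz h
      exact hz (inv_injective h ▸ hω)⟩
  refine tendsto_nhds_unique (f := fun z ↦ aeval z P) ?_ ((hc.comp hinv).congr' ?_)
  · exact ((Polynomial.continuous_aeval P).tendsto ω).mono_left nhdsWithin_le_nhds
  · filter_upwards [self_mem_nhdsWithin] with z hz
    exact (aeval_eq_sievingProduct_of_transcendental hn hk hP hz).symm

end SpecializationAtTranscendentals

end RootsOfUnity

section NormFibers

lemma natCard_isRoot_of_dvd {K : Type*} [Field K] [Finite K] {p : K[X]}
    (hp : p ∣ X ^ Nat.card K - X) : Nat.card {a // p.IsRoot a} = p.natDegree := by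
  classical
  have := Fintype.ofFinite K
  rw [Nat.card_eq_fintype_card] at hp
  have hne := FiniteField.X_pow_card_sub_X_ne_zero K (Fintype.one_lt_card (α := K))
  have hsplits : p.Splits := by
    have h := (FiniteField.isSplittingField_sub K K).splits
    rw [Algebra.algebraMap_self, map_id] at h
    exact h.of_dvd hne hp
  have hnodup : p.roots.Nodup := Multiset.nodup_of_le (roots.le_of_dvd hne hp) <| by
    rw [FiniteField.roots_X_pow_card_sub_X]
    exact univ.nodup
  rw [hsplits.natDegree_eq_card_roots, ← Multiset.toFinset_card_of_nodup hnodup]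
  exact Nat.subtype_card _ fun a ↦ by simp [mem_roots (ne_zero_of_dvd_ne_zero hne hp)]

variable {K : Type*} [Field K] {q : ℕ}

lemma natCard_pow_succ_eq (hK : Nat.card K = q ^ 2) (hq : q ≠ 0) {c : K} (hc₀ : c ≠ 0)
    (hc : c ^ q = c) : Nat.card {a : K // a ^ (q + 1) = c} = q + 1 := by
  have : Finite K := Nat.finite_of_card_ne_zero (by rw [hK]; positivity)
  obtain ⟨r, rfl⟩ := Nat.exists_eq_succ_of_ne_zero hq
  have hcr : c ^ r = 1 := mul_right_cancel₀ hc₀ (by rw [← pow_succ, hc, one_mul])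
  have hdvd : X ^ (r + 1 + 1) - C c ∣ (X ^ Nat.card K - X : K[X]) := by
    have h := sub_dvd_pow_sub_pow (X ^ (r + 1 + 1)) (C c) r
    rw [← C_pow, hcr, C_1, ← pow_mul] at h
    refine h.trans ⟨X, ?_⟩
    rw [hK, sub_mul, ← pow_succ, one_mul]
    congr 2
    simp only [Nat.succ_eq_add_one]
    ring
  have hcard := natCard_isRoot_of_dvd hdvd
  rw [natDegree_X_pow_sub_C] at hcard
  simpa [IsRoot.def, sub_eq_zero] using hcard

end NormFibers

section OrthogonalSplitting

variable {K V : Type*} [Field K] [AddCommGroup V] [Module K V] {f : V →ₗ[K] K} {v : V}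
  {W : Submodule K V}

/-- The splitting of a subspace `W` along the kernel of a linear form `f` and a vector of `W` on
which `f` does not vanish. -/
def kerProdEquiv (f : V →ₗ[K] K) (hv : v ∈ W) (hfv : f v ≠ 0) : (↥(W ⊓ f.ker) × K) ≃ₗ[K] W where
  toFun p := ⟨p.1 + p.2 • v, W.add_mem p.1.2.1 (W.smul_mem _ hv)⟩
  map_add' p p' := by
    ext
    simp only [Prod.fst_add, Prod.snd_add, Submodule.coe_add, add_smul]
    abel
  map_smul' a p := by
    ext
    simp [mul_smul]
  invFun w := (⟨w - (f w / f v) • v, W.sub_mem w.2 (W.smul_mem _ hv), by simp [hfv]⟩, f w / f v)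
  left_inv := by
    rintro ⟨⟨x, _, hx⟩, a⟩
    have hx : f x = 0 := hx
    ext <;> simp [hx, hfv]
  right_inv w := by simp

lemma finrank_inf_ker_add_one [Module.Finite K V] (hv : v ∈ W) (hfv : f v ≠ 0) :
    Module.finrank K ↥(W ⊓ f.ker) + 1 = Module.finrank K W := by
  rw [← (kerProdEquiv f hv hfv).finrank_eq, Module.finrank_prod, Module.finrank_self]

lemma inf_ker_sup_span_singleton (hv : v ∈ W) (hfv : f v ≠ 0) : W ⊓ f.ker ⊔ K ∙ v = W := by
  rw [inf_sup_assoc_of_le _ ((Submodule.span_singleton_le_iff_mem v W).2 hv), sup_comm,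
    f.span_singleton_sup_ker_eq_top hfv, inf_top_eq]

lemma sup_span_singleton_inf_ker (hW : W ≤ f.ker) (hfv : f v ≠ 0) :
    (W ⊔ K ∙ v) ⊓ f.ker = W := by
  have hdisj : K ∙ v ⊓ f.ker = ⊥ :=
    ((Submodule.disjoint_span_singleton' fun h ↦ hfv (by rw [h, map_zero])).2 hfv).symm.eq_bot
  rw [sup_inf_assoc_of_le _ hW, hdisj, sup_bot_eq]

variable {σ : K →+* K} {B : V →ₛₗ[σ] V →ₗ[K] K}

lemma disjoint_orthogonalBilin_inf_ker (hW : Disjoint W (W.orthogonalBilin B)) (hv : v ∈ W)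
    (hvv : B v v ≠ 0) :
    Disjoint (W ⊓ (B v).ker) ((W ⊓ (B v).ker).orthogonalBilin B) := by
  refine Submodule.disjoint_def.2 fun x ⟨hxW, hxv⟩ hx ↦
    Submodule.disjoint_def.1 hW x hxW fun w hw ↦ ?_
  rw [← inf_ker_sup_span_singleton hv hvv] at hw
  obtain ⟨w', hw', z, hz, rfl⟩ := Submodule.mem_sup.1 hw
  obtain ⟨a, rfl⟩ := Submodule.mem_span_singleton.1 hz
  rw [map_add, LinearMap.add_apply, hx w' hw', LinearMap.map_smulₛₗ₂, LinearMap.mem_ker.1 hxv,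
    smul_zero, add_zero]

lemma disjoint_orthogonalBilin_sup_span_singleton (hW : Disjoint W (W.orthogonalBilin B))
    (hWv : W ≤ (B v).ker) (hvv : B v v ≠ 0) :
    Disjoint (W ⊔ K ∙ v) ((W ⊔ K ∙ v).orthogonalBilin B) := by
  refine Submodule.disjoint_def.2 fun x hxW hx ↦ ?_
  have hxv : x ∈ (B v).ker := hx v (Submodule.mem_sup_right (Submodule.mem_span_singleton_self v))
  have hxW' : x ∈ W := sup_span_singleton_inf_ker hWv hvv ▸ ⟨hxW, hxv⟩
  exact Submodule.disjoint_def.1 hW x hxW' fun w hw ↦ hx w (Submodule.mem_sup_left hw)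

variable {U : Submodule K V} {k : ℕ}

/-- The nondegenerate `k`-dimensional subspaces of `U`: those with zero radical for `B`. -/
def nondegenerateSubspacesOf (B : V →ₛₗ[σ] V →ₗ[K] K) (U : Submodule K V) (k : ℕ) :
    Set (Submodule K V) :=
  {W | W ≤ U ∧ Module.finrank K W = k ∧ Disjoint W (W.orthogonalBilin B)}

lemma natCard_nondegenerateSubspacesOf_zero [Module.Finite K V] :
    Nat.card (nondegenerateSubspacesOf B U 0) = 1 := by
  have hbot : nondegenerateSubspacesOf B U 0 = {⊥} := by
    refine Set.eq_singleton_iff_unique_mem.2 ⟨⟨bot_le, finrank_bot K V, disjoint_bot_left⟩, ?_⟩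
    exact fun W hW ↦ Submodule.finrank_eq_zero.1 hW.2.1
  rw [hbot, Nat.card_unique]

lemma natCard_nondegenerateSubspacesOf_mem [Module.Finite K V] (hv : v ∈ U) (hvv : B v v ≠ 0) :
    Nat.card {W : nondegenerateSubspacesOf B U (k + 1) // v ∈ W.1} =
      Nat.card (nondegenerateSubspacesOf B (U ⊓ (B v).ker) k) :=
  Nat.card_congr
    { toFun W := ⟨W.1.1 ⊓ (B v).ker, inf_le_inf_right _ W.1.2.1, by
        have := finrank_inf_ker_add_one W.2 hvv
        have := W.1.2.2.1
        lia, disjoint_orthogonalBilin_inf_ker W.1.2.2.2 W.2 hvv⟩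
      invFun W :=
        have hWv : W.1 ≤ (B v).ker := W.2.1.trans inf_le_right
        have hmem : v ∈ W.1 ⊔ K ∙ v :=
          Submodule.mem_sup_right (Submodule.mem_span_singleton_self v)
        ⟨⟨W.1 ⊔ K ∙ v, sup_le (W.2.1.trans inf_le_left)
          ((Submodule.span_singleton_le_iff_mem v U).2 hv), by
          rw [← finrank_inf_ker_add_one hmem hvv, sup_span_singleton_inf_ker hWv hvv, W.2.2.1],
          disjoint_orthogonalBilin_sup_span_singleton W.2.2.2 hWv hvv⟩, hmem⟩
      left_inv W := Subtype.ext (Subtype.ext (inf_ker_sup_span_singleton W.2 hvv))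
      right_inv W := Subtype.ext
        (sup_span_singleton_inf_ker (W.2.1.trans inf_le_right) hvv) }

end OrthogonalSplitting

section HermitianCount

lemma exists_add_pow_ne_zero {K : Type*} [Field K] {q : ℕ} (hK : Nat.card K = q ^ 2)
    (hq : 2 ≤ q) : ∃ t : K, t + t ^ q ≠ 0 := by
  have : Finite K := Nat.finite_of_card_ne_zero (by rw [hK]; positivity)
  have hne : (X + X ^ q : K[X]) ≠ 0 := fun h ↦ by
    simpa [coeff_X_pow, show 1 ≠ q by lia] using congrArg (coeff · 1) h
  have hdeg : (X + X ^ q : K[X]).natDegree < Cardinal.mk K := by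
    rw [← Nat.cast_card, Nat.cast_lt, hK]
    refine (natDegree_add_le _ _).trans_lt ?_
    rw [natDegree_X, natDegree_X_pow]
    exact max_lt (by nlinarith) (by nlinarith)
  simpa using exists_eval_ne_zero_of_natDegree_lt_card _ hne hdeg

variable {K V : Type*} [Field K] [AddCommGroup V] [Module K V] {σ : K →+* K}
  {B : V →ₛₗ[σ] V →ₗ[K] K} {q : ℕ} {W : Submodule K V} {v : V}

lemma exists_mem_anisotropic (hσ : ∀ a, σ a = a ^ q) (hK : Nat.card K = q ^ 2) (hq : 2 ≤ q)
    (hB : B.IsSymm) (hW : Disjoint W (W.orthogonalBilin B)) (hW₀ : W ≠ ⊥) :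
    ∃ v ∈ W, B v v ≠ 0 := by
  by_contra! hiso
  obtain ⟨y, hy, hy₀⟩ := W.ne_bot_iff.1 hW₀
  refine hy₀ (Submodule.disjoint_def.1 hW y hy fun x hx ↦ by_contra fun hxy ↦ ?_)
  obtain ⟨t, ht⟩ := exists_add_pow_ne_zero hK hq
  have hty : B x ((t / B x y) • y) = t := by rw [map_smul, smul_eq_mul, div_mul_cancel₀ _ hxy]
  have hy' := W.smul_mem (t / B x y) hy
  generalize (t / B x y) • y = y' at hty hy'
  have h := hiso (x + y') (W.add_mem hx hy')
  rw [map_add, LinearMap.map_add₂, LinearMap.map_add₂, hiso x hx, hiso y' hy', ← hB.eq x, hty, hσ,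
    zero_add, add_zero, add_comm] at h
  exact ht h

/-- The number of anisotropic vectors of `W`. -/
noncomputable def anisotropicCard (B : V →ₛₗ[σ] V →ₗ[K] K) (W : Submodule K V) : ℕ :=
  Nat.card {w : W // B w w ≠ 0}

lemma natCard_isotropic_add_anisotropicCard [Finite W] :
    Nat.card {w : W // B w w = 0} + anisotropicCard B W = Nat.card W := by
  classical
  rw [anisotropicCard, ← Nat.card_sum]
  exact Nat.card_congr (Equiv.sumCompl _)

open Classical in
lemma natCard_isotropic_line (hσ : ∀ a, σ a = a ^ q) (hK : Nat.card K = q ^ 2) (hq : q ≠ 0)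
    (hB : B.IsSymm) (hvv : B v v ≠ 0) {x : V} (hx : x ∈ (B v).ker) :
    Nat.card {a : K // B (x + a • v) (x + a • v) = 0} = 1 + if B x x ≠ 0 then q else 0 := by
  have hvx : B v x = 0 := hx
  have hxv : B x v = 0 := hB.isRefl.eq_zero hvx
  have hnorm (a : K) : B (x + a • v) (x + a • v) = 0 ↔ a ^ (q + 1) = -B x x / B v v := by
    rw [eq_div_iff hvv, eq_neg_iff_add_eq_zero]
    simp only [LinearMap.map_add₂, LinearMap.map_smulₛₗ₂, map_add (B _), map_smul (B _), hxv, hvx,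
      hσ, smul_eq_mul, mul_zero, add_zero, zero_add]
    ring_nf
  simp only [hnorm]
  split_ifs with hxx
  · rw [natCard_pow_succ_eq hK hq (div_ne_zero (neg_ne_zero.2 hxx) hvv), add_comm]
    rw [← hσ, map_div₀, map_neg, hB.eq, hB.eq]
  · simp [not_not.1 hxx]

open Classical in
lemma natCard_isotropic (hσ : ∀ a, σ a = a ^ q) (hK : Nat.card K = q ^ 2) (hq : q ≠ 0)
    (hB : B.IsSymm) [Finite V] (hv : v ∈ W) (hvv : B v v ≠ 0) :
    Nat.card {w : W // B w w = 0} =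
      Nat.card ↥(W ⊓ (B v).ker) + q * anisotropicCard B (W ⊓ (B v).ker) := by
  have : Finite K := Nat.finite_of_card_ne_zero (by rw [hK]; positivity)
  have := Fintype.ofFinite ↥(W ⊓ (B v).ker)
  have hequiv : {p : ↥(W ⊓ (B v).ker) × K //
      B (p.1 + p.2 • v : V) (p.1 + p.2 • v) = 0} ≃ {w : W // B w w = 0} :=
    (kerProdEquiv (B v) hv hvv).toEquiv.subtypeEquiv fun _ ↦ Iff.rfl
  rw [← Nat.card_congr hequiv, Nat.card_congr (Equiv.subtypeProdEquivSigmaSubtype fun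
    (x : ↥(W ⊓ (B v).ker)) (a : K) ↦ B (x + a • v : V) (x + a • v) = 0), Nat.card_sigma]
  rw [sum_congr rfl fun x _ ↦ natCard_isotropic_line hσ hK hq hB hvv x.2.2, sum_add_distrib,
    ← sum_filter, sum_const, sum_const, smul_eq_mul, smul_eq_mul, mul_one, card_univ,
    anisotropicCard, Nat.card_eq_fintype_card, Nat.card_eq_fintype_card,
    Fintype.card_subtype fun w : ↥(W ⊓ (B v).ker) ↦ B w w ≠ 0, mul_comm]

lemma mul_anisotropicCard (hσ : ∀ a, σ a = a ^ q) (hK : Nat.card K = q ^ 2) (hq : 2 ≤ q)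
    (hB : B.IsSymm) [Module.Finite K V] {d : ℕ} (hW : Disjoint W (W.orthogonalBilin B))
    (hd : Module.finrank K W = d) :
    (-q : ℤ) * anisotropicCard B W = (-q + 1) * (-q) ^ d * ((-q) ^ d - 1) := by
  have : Finite K := Nat.finite_of_card_ne_zero (by rw [hK]; positivity)
  have : Finite V := Module.finite_of_finite K
  induction d generalizing W with
  | zero =>
    obtain rfl : W = ⊥ := Submodule.finrank_eq_zero.1 hd
    have : IsEmpty {w : (⊥ : Submodule K V) // B w w ≠ 0} :=
      ⟨fun w ↦ w.2 (by simp [(Submodule.mem_bot K).1 w.1.2])⟩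
    simp [anisotropicCard]
  | succ d ih =>
    obtain ⟨v, hv, hvv⟩ := exists_mem_anisotropic hσ hK hq hB hW (by rintro rfl; simp at hd)
    have hd' : Module.finrank K ↥(W ⊓ (B v).ker) = d := by
      rw [← Nat.add_right_cancel_iff, finrank_inf_ker_add_one hv hvv, hd]
    have hih := ih (disjoint_orthogonalBilin_inf_ker hW hv hvv) hd'
    have hcount := natCard_isotropic_add_anisotropicCard (B := B) (W := W)
    rw [natCard_isotropic hσ hK (by lia) hB hv hvv, Module.natCard_eq_pow_finrank (K := K),
      Module.natCard_eq_pow_finrank (K := K) (V := W), hd, hd', hK] at hcount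
    zify at hcount
    rw [← neg_sq (q : ℤ), ← pow_mul, ← pow_mul, mul_comm 2, mul_comm 2, pow_mul, pow_mul] at hcount
    linear_combination (-q : ℤ) * hcount - q * hih

variable {U : Submodule K V} {k : ℕ}

/-- The double count of the incident pairs of a nondegenerate subspace of `U` and an anisotropic
vector. -/
def anisotropicIncidenceEquiv :
    (Σ W : nondegenerateSubspacesOf B U k, {w : W.1 // B w w ≠ 0}) ≃
      Σ v : {v : U // B v v ≠ 0}, {W : nondegenerateSubspacesOf B U k // (v : V) ∈ W.1} where
  toFun p := ⟨⟨⟨p.2.1, p.1.2.1 p.2.1.2⟩, p.2.2⟩, p.1, p.2.1.2⟩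
  invFun p := ⟨p.2.1, ⟨p.1.1, p.2.2⟩, p.1.2⟩
  left_inv _ := rfl
  right_inv _ := rfl

lemma sum_anisotropicCard [Finite V]
    [Fintype (nondegenerateSubspacesOf B U (k + 1))] [Fintype {v : U // B v v ≠ 0}] :
    ∑ W : nondegenerateSubspacesOf B U (k + 1), anisotropicCard B W.1 =
      ∑ v : {v : U // B v v ≠ 0}, Nat.card (nondegenerateSubspacesOf B (U ⊓ (B v).ker) k) := by
  have hcard := Nat.card_congr (anisotropicIncidenceEquiv (B := B) (U := U) (k := k + 1))
  rw [Nat.card_sigma, Nat.card_sigma] at hcard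
  exact hcard.trans (sum_congr rfl fun v _ ↦ natCard_nondegenerateSubspacesOf_mem v.1.2 v.2)

lemma mul_sum_anisotropicCard (hσ : ∀ a, σ a = a ^ q) (hK : Nat.card K = q ^ 2) (hq : 2 ≤ q)
    (hB : B.IsSymm) [Module.Finite K V] [Fintype (nondegenerateSubspacesOf B U k)] :
    (-q : ℤ) * ↑(∑ W : nondegenerateSubspacesOf B U k, anisotropicCard B W.1) =
      Nat.card (nondegenerateSubspacesOf B U k) * ((-q + 1) * (-q) ^ k * ((-q) ^ k - 1)) := by
  rw [Nat.cast_sum, mul_sum, sum_congr rfl fun W _ ↦ mul_anisotropicCard hσ hK hq hB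
    W.2.2.2 W.2.2.1, sum_const, card_univ, nsmul_eq_mul, Nat.card_eq_fintype_card]

lemma prod_pow_succ_sub_pow {R : Type*} [CommRing R] (x : R) (N k : ℕ) :
    ∏ j ∈ range (k + 1), (x ^ (N + 1) - x ^ j) =
      x ^ k * (x ^ (N + 1) - 1) * ∏ j ∈ range k, (x ^ N - x ^ j) := by
  have hfactor (j : ℕ) : x ^ (N + 1) - x ^ (j + 1) = x * (x ^ N - x ^ j) := by ring
  simp only [prod_range_succ', hfactor, prod_mul_distrib, prod_const, card_range, pow_zero]
  ring

theorem natCard_nondegenerateSubspacesOf_mul_prod (hσ : ∀ a, σ a = a ^ q)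
    (hK : Nat.card K = q ^ 2) (hq : 2 ≤ q) (hB : B.IsSymm) [Module.Finite K V] {l : ℕ}
    (hU : Disjoint U (U.orthogonalBilin B)) (hd : Module.finrank K U = k + l) :
    (Nat.card (nondegenerateSubspacesOf B U k) : ℤ) *
        ∏ j ∈ range k, ((-q : ℤ) ^ k - (-q) ^ j) =
      ∏ j ∈ range k, (-q) ^ l * ((-q : ℤ) ^ (k + l) - (-q) ^ j) := by
  have : Finite K := Nat.finite_of_card_ne_zero (by rw [hK]; positivity)
  have : Finite V := Module.finite_of_finite K
  induction k generalizing U with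
  | zero => rw [natCard_nondegenerateSubspacesOf_zero]; rfl
  | succ k ih =>
    have := Fintype.ofFinite (nondegenerateSubspacesOf B U (k + 1))
    have := Fintype.ofFinite {v : U // B v v ≠ 0}
    have hleft := mul_sum_anisotropicCard hσ hK hq hB (U := U) (k := k + 1)
    have hright : (↑(∑ v : {v : U // B v v ≠ 0},
          Nat.card (nondegenerateSubspacesOf B (U ⊓ (B v).ker) k)) : ℤ) *
          ∏ j ∈ range k, ((-q : ℤ) ^ k - (-q) ^ j) =
        anisotropicCard B U * ∏ j ∈ range k, (-q) ^ l * ((-q : ℤ) ^ (k + l) - (-q) ^ j) := by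
      have hfinrank (v : {v : U // B v v ≠ 0}) :
          Module.finrank K ↥(U ⊓ (B v).ker) = k + l := by
        have := finrank_inf_ker_add_one v.1.2 v.2
        lia
      rw [Nat.cast_sum, sum_mul, sum_congr rfl fun v _ ↦
        ih (disjoint_orthogonalBilin_inf_ker hU v.1.2 v.2) (hfinrank v), sum_const, card_univ,
        nsmul_eq_mul, anisotropicCard, Nat.card_eq_fintype_card]
    have hne : (-q : ℤ) * (-q + 1) ≠ 0 := mul_ne_zero (by lia) (by lia)
    rw [sum_anisotropicCard] at hleft
    rw [prod_mul_distrib, prod_const, card_range] at hright ⊢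
    rw [add_right_comm k 1 l, prod_pow_succ_sub_pow, prod_pow_succ_sub_pow]
    refine mul_left_cancel₀ hne ?_
    linear_combination (-q : ℤ) * hright -
      (∏ j ∈ range k, ((-q : ℤ) ^ k - (-q) ^ j)) * hleft + ((-q : ℤ) ^ l) ^ k *
      (∏ j ∈ range k, ((-q : ℤ) ^ (k + l) - (-q) ^ j)) * mul_anisotropicCard hσ hK hq hB hU hd

end HermitianCount

section TraceForm

lemma exists_charP_and_eq_pow {K : Type*} [Field K] [Finite K] {q : ℕ}
    (hK : Nat.card K = q ^ 2) : ∃ p e : ℕ, p.Prime ∧ CharP K p ∧ q = p ^ e := by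
  have := Fintype.ofFinite K
  obtain ⟨p, hchar, d, hp, hd⟩ := FiniteField.card' K
  obtain ⟨e, -, he⟩ := (Nat.dvd_prime_pow hp).1 ⟨q, by rw [← sq, ← hK, ← hd,
    Nat.card_eq_fintype_card]⟩
  exact ⟨p, e, hp, hchar, he⟩

lemma pow_pow_self_of_natCard_eq {L : Type*} [Field L] [Finite L] {q : ℕ}
    (hL : Nat.card L = q ^ 2) (x : L) : (x ^ q) ^ q = x := by
  have := Fintype.ofFinite L
  rw [← pow_mul, ← sq, ← hL, Nat.card_eq_fintype_card, FiniteField.pow_card]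

variable {M L : Type*} [Field M] [Field L] [Algebra M L]

lemma trace_pow_expChar_pow [Finite L] (p e : ℕ) [ExpChar L p] (x : L) :
    Algebra.trace M L (x ^ p ^ e) = Algebra.trace M L x ^ p ^ e := by
  apply FaithfulSMul.algebraMap_injective M L
  rw [map_pow (algebraMap M L), FiniteField.algebraMap_trace_eq_sum_pow,
    FiniteField.algebraMap_trace_eq_sum_pow, sum_pow_char_pow]
  exact sum_congr rfl fun _ _ ↦ pow_right_comm ..

/-- The trace form in characteristic `p` as a sesquilinear map. The arguments are swapped, since
in Mathlib's convention it is the first one that is semilinear. -/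
noncomputable def frobeniusTraceForm (M L : Type*) [Field M] [Field L] [Algebra M L]
    (p e : ℕ) [ExpChar M p] [ExpChar L p] : L →ₛₗ[iterateFrobenius M p e] L →ₗ[M] M :=
  LinearMap.mk₂'ₛₗ _ _ (fun y x ↦ traceForm p e M x y)
    (fun y y' x ↦ by simp only [traceForm, add_pow_expChar_pow, mul_add, map_add])
    (fun a y x ↦ by
      rw [traceForm, _root_.smul_pow, mul_smul_comm, map_smul, iterateFrobenius_def, traceForm])
    (fun y x x' ↦ by simp only [traceForm, add_mul, map_add])
    (fun a y x ↦ by rw [traceForm, smul_mul_assoc, map_smul, RingHom.id_apply, traceForm])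

lemma frobeniusTraceForm_isSymm [Finite L] {p e : ℕ} [ExpChar M p] [ExpChar L p]
    (hL : Nat.card L = (p ^ e) ^ 2) : (frobeniusTraceForm M L p e).IsSymm where
  eq y x := by
    change traceForm p e M x y ^ p ^ e = traceForm p e M y x
    rw [traceForm, ← trace_pow_expChar_pow, mul_pow, pow_pow_self_of_natCard_eq hL, mul_comm,
      traceForm]

lemma isNondegenerateSubspace_iff_disjoint {p e : ℕ} [ExpChar M p] [ExpChar L p]
    {W : Submodule M L} :
    IsNondegenerateSubspace p e W ↔
      Disjoint W (W.orthogonalBilin (frobeniusTraceForm M L p e)) :=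
  (Submodule.disjoint_def (p' := W.orthogonalBilin (frobeniusTraceForm M L p e))).symm

lemma isNondegenerateSubspace_top [Finite L] {q n : ℕ} (hL : Nat.card L = (q ^ n) ^ 2) :
    IsNondegenerateSubspace q n (⊤ : Submodule M L) := by
  have := Finite.of_injective _ (FaithfulSMul.algebraMap_injective M L)
  refine fun x _ hx ↦ (traceForm_nondegenerate M L).1 x fun y ↦ ?_
  rw [Algebra.traceForm_apply, ← pow_pow_self_of_natCard_eq hL y]
  exact hx (y ^ q ^ n) trivial

lemma nondegenerateSubspaces_pow (q m n r : ℕ) :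
    nondegenerateSubspaces (q ^ m) n r M L = nondegenerateSubspaces q (m * n) r M L := by
  simp only [nondegenerateSubspaces, IsNondegenerateSubspace, traceForm, pow_mul]

theorem natCard_nondegenerateSubspaces_mul_prod [Finite L] {q r l : ℕ}
    (hM : Nat.card M = q ^ 2) (hodd : Odd (Module.finrank M L))
    (hrl : Module.finrank M L = r + l) :
    (Nat.card (nondegenerateSubspaces q (r + l) r M L) : ℤ) *
        ∏ j ∈ range r, ((-q : ℤ) ^ r - (-q) ^ j) =
      ∏ j ∈ range r, (-q) ^ l * ((-q : ℤ) ^ (r + l) - (-q) ^ j) := by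
  have := Finite.of_injective _ (FaithfulSMul.algebraMap_injective M L)
  have := Fintype.ofFinite M
  obtain ⟨p, e, hp, _, rfl⟩ := exists_charP_and_eq_pow hM
  have : Fact p.Prime := ⟨hp⟩
  have : CharP L p := charP_of_injective_algebraMap (FaithfulSMul.algebraMap_injective M L) p
  have hL : Nat.card L = (p ^ (e * (r + l))) ^ 2 := by
    rw [Module.natCard_eq_pow_finrank (K := M), hM, hrl]
    ring
  have hσ (a : M) : iterateFrobenius M p (e * (r + l)) a = a ^ p ^ e := by
    obtain ⟨s, hs⟩ := hodd
    have hfrob := FiniteField.pow_card_pow s a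
    rw [← Nat.card_eq_fintype_card, hM] at hfrob
    rw [iterateFrobenius_def, ← hrl, hs, pow_mul, pow_succ, pow_mul, pow_mul, hfrob]
  have hq : 2 ≤ p ^ e := by
    have := Finite.one_lt_card (α := M)
    rw [hM] at this
    exact (Nat.one_lt_pow_iff two_ne_zero).1 this
  have hset : nondegenerateSubspaces (p ^ e) (r + l) r M L =
      nondegenerateSubspacesOf (frobeniusTraceForm M L p (e * (r + l))) ⊤ r := by
    ext W
    rw [nondegenerateSubspaces_pow, nondegenerateSubspacesOf, Set.mem_ofPred_eq,
      ← isNondegenerateSubspace_iff_disjoint]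
    exact (and_iff_right le_top).symm
  rw [hset]
  exact natCard_nondegenerateSubspacesOf_mul_prod hσ hM hq (frobeniusTraceForm_isSymm hL)
    (isNondegenerateSubspace_iff_disjoint.1 (isNondegenerateSubspace_top hL))
    (by rw [finrank_top, hrl])

end TraceForm

section FixedSubspaces

open IntermediateField

variable {K L : Type*} [Field K] [Field L] [Algebra K L] {q n k : ℕ}

lemma traceForm_smul_smul {c : Lˣ} (hc : c ^ (q ^ n + 1) = 1) (x y : L) :
    traceForm q n K (c • x) (c • y) = traceForm q n K x y := by
  have hc : (c : L) ^ (q ^ n + 1) = 1 := by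
    rw [← Units.val_pow_eq_pow_val, hc, Units.val_one]
  rw [traceForm, traceForm, Units.smul_def, Units.smul_def, smul_eq_mul, smul_eq_mul, mul_pow,
    mul_mul_mul_comm, ← pow_succ', hc, one_mul]

lemma finrank_units_smul (c : Lˣ) (W : Submodule K L) :
    Module.finrank K ↥(c • W) = Module.finrank K W :=
  (Submodule.equivMapOfInjective (DistribSMul.toLinearMap K L c) (MulAction.injective c)
    W).finrank_eq.symm

lemma smul_mem_nondegenerateSubspaces {c : Lˣ} (hc : c ^ (q ^ n + 1) = 1) {W : Submodule K L}
    (hW : W ∈ nondegenerateSubspaces q n k K L) : c • W ∈ nondegenerateSubspaces q n k K L := by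
  refine ⟨(finrank_units_smul c W).trans hW.1, fun y hy hyW ↦ ?_⟩
  obtain ⟨x, hx, rfl⟩ := (Submodule.mem_smul_pointwise_iff_exists _ _ _).1 hy
  rw [hW.2 x hx fun z hz ↦ ?_, smul_zero]
  rw [← traceForm_smul_smul hc]
  exact hyW (c • z) (Submodule.smul_mem_pointwise_smul z c W hz)

lemma isNondegenerateSubspace_restrictScalars_iff {M : Type*} [Field M] [Algebra K M]
    [Algebra M L] [IsScalarTower K M L] [Finite L] (hL : Nat.card L = (q ^ n) ^ 2)
    {W : Submodule M L} :
    IsNondegenerateSubspace q n (W.restrictScalars K) ↔ IsNondegenerateSubspace q n W := by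
  have := Finite.of_injective _ (FaithfulSMul.algebraMap_injective M L)
  have := Finite.of_injective _ (FaithfulSMul.algebraMap_injective K M)
  have htrace (x y : L) : traceForm q n K x y = Algebra.trace K M (traceForm q n M x y) :=
    (Algebra.trace_trace _).symm
  refine forall₂_congr fun x _ ↦ imp_congr_left ⟨fun h y hy ↦ ?_, fun h y hy ↦ ?_⟩
  · by_contra hxy
    obtain ⟨b, hb⟩ := Algebra.trace_surjective K M 1
    set a := b / traceForm q n M x y
    have hscale : traceForm q n M x ((algebraMap M L a) ^ q ^ n * y) = b := by
      rw [traceForm, mul_pow, pow_pow_self_of_natCard_eq hL, mul_left_comm, ← Algebra.smul_def,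
        map_smul, smul_eq_mul]
      exact div_mul_cancel₀ b hxy
    have hmem : (algebraMap M L a) ^ q ^ n * y ∈ W := by
      rw [← map_pow, ← Algebra.smul_def]
      exact W.smul_mem _ hy
    have hzero := h _ hmem
    rw [htrace, hscale, hb] at hzero
    exact one_ne_zero hzero
  · rw [htrace, h y hy, map_zero]

lemma mul_mem_of_mem_adjoin_simple {c : L} (hc : IsAlgebraic K c) {W : Submodule K L}
    (hcW : ∀ x ∈ W, c * x ∈ W) {a x : L} (ha : a ∈ K⟮c⟯) (hx : x ∈ W) : a * x ∈ W := by
  rw [← mem_toSubalgebra, adjoin_simple_toSubalgebra_of_isAlgebraic hc] at ha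
  induction ha using Algebra.adjoin_induction generalizing x with
  | mem y hy => exact Set.mem_singleton_iff.1 hy ▸ hcW x hx
  | algebraMap r => exact Algebra.smul_def r x ▸ W.smul_mem r hx
  | add y z _ _ ihy ihz => exact add_mul y z x ▸ W.add_mem (ihy hx) (ihz hx)
  | mul y z _ _ ihy ihz => exact mul_assoc y z x ▸ ihy (ihz hx)

lemma smul_eq_self_iff_exists_restrictScalars [FiniteDimensional K L] {c : Lˣ}
    {W : Submodule K L} :
    c • W = W ↔ ∃ W' : Submodule K⟮(c : L)⟯ L, W'.restrictScalars K = W := by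
  constructor
  · intro hcW
    have hmul (x) (hx : x ∈ W) : (c : L) * x ∈ W :=
      hcW.le (Submodule.smul_mem_pointwise_smul x c W hx)
    exact ⟨{ W with smul_mem' a x hx :=
      mul_mem_of_mem_adjoin_simple (Algebra.IsAlgebraic.isAlgebraic _) hmul a.2 hx }, rfl⟩
  · rintro ⟨W', rfl⟩
    refine Submodule.eq_of_le_of_finrank_eq (fun y hy ↦ ?_) (finrank_units_smul c _)
    obtain ⟨x, hx, rfl⟩ := (Submodule.mem_smul_pointwise_iff_exists _ _ _).1 hy
    exact W'.smul_mem (AdjoinSimple.gen K (c : L)) hx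

lemma finrank_adjoin_dvd_of_smul_eq_self [FiniteDimensional K L] {c : Lˣ} {W : Submodule K L}
    (hcW : c • W = W) :
    Module.finrank K K⟮(c : L)⟯ ∣ Module.finrank K W := by
  obtain ⟨W', rfl⟩ := smul_eq_self_iff_exists_restrictScalars.1 hcW
  exact ⟨_, (Module.finrank_mul_finrank K K⟮(c : L)⟯ W').symm⟩

variable [Finite L]

lemma setOf_smul_eq_self (hL : Nat.card L = (q ^ n) ^ 2) {c : Lˣ} {r : ℕ} :
    {W : Submodule K L | W ∈ nondegenerateSubspaces q n (Module.finrank K K⟮(c : L)⟯ * r) K L ∧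
        c • W = W} =
      Submodule.restrictScalars K '' nondegenerateSubspaces q n r K⟮(c : L)⟯ L := by
  ext W
  have hfinrank (W' : Submodule K⟮(c : L)⟯ L) :
      Module.finrank K (W'.restrictScalars K) = Module.finrank K K⟮(c : L)⟯ * r ↔
        Module.finrank K⟮(c : L)⟯ W' = r := by
    change Module.finrank K W' = _ ↔ _
    rw [← Module.finrank_mul_finrank K K⟮(c : L)⟯ W', Nat.mul_right_inj Module.finrank_pos.ne']
  constructor
  · rintro ⟨⟨hWk, hW⟩, hcW⟩
    obtain ⟨W', rfl⟩ := smul_eq_self_iff_exists_restrictScalars.1 hcW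
    exact ⟨W', ⟨(hfinrank W').1 hWk, (isNondegenerateSubspace_restrictScalars_iff hL).1 hW⟩, rfl⟩
  · rintro ⟨W', ⟨hWk, hW⟩, rfl⟩
    exact ⟨⟨(hfinrank W').2 hWk, (isNondegenerateSubspace_restrictScalars_iff hL).2 hW⟩,
      smul_eq_self_iff_exists_restrictScalars.2 ⟨W', rfl⟩⟩

lemma finrank_adjoin_eq_orderOf (c : Lˣ) :
    Module.finrank K K⟮(c : L)⟯ = orderOf (Nat.card K : ZMod (orderOf c)) := by
  have := Finite.of_injective _ (FaithfulSMul.algebraMap_injective K L)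
  have := Fintype.ofFinite K
  rw [← FiniteField.orderOf_frobeniusAlgHom K K⟮(c : L)⟯, orderOf_eq_orderOf_iff]
  intro i
  have hpow : (Nat.card K : ZMod (orderOf c)) ^ i = 1 ↔ (c : L) ^ Nat.card K ^ i = c := by
    rw [← Nat.cast_pow, ← Nat.cast_one, ZMod.natCast_eq_natCast_iff, ← pow_eq_pow_iff_modEq,
      pow_one, ← Units.val_inj, Units.val_pow_eq_pow_val]
  have hfrob : ((FiniteField.frobeniusAlgHom K K⟮(c : L)⟯ ^ i) (AdjoinSimple.gen K (c : L)) : L) =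
      (c : L) ^ Nat.card K ^ i := by
    rw [AlgHom.coe_pow, FiniteField.coe_frobeniusAlgHom, pow_iterate, Nat.card_eq_fintype_card]
    rfl
  rw [hpow, ← hfrob]
  refine ⟨fun h ↦ by rw [h]; rfl, fun h ↦ algHom_ext_of_eq_adjoin K rfl fun x hx ↦ ?_⟩
  obtain rfl := Set.mem_singleton_iff.1 hx
  exact Subtype.ext h

lemma orderOf_neg_eq_finrank_adjoin (hK : Nat.card K = q ^ 2) (hn : Odd n) {c : Lˣ}
    (hq : ((-q : ℤ) : ZMod (orderOf c)) ^ n = 1) :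
    orderOf ((-q : ℤ) : ZMod (orderOf c)) = Module.finrank K K⟮(c : L)⟯ := by
  have hodd := hn.of_dvd_nat (orderOf_dvd_of_pow_eq_one hq)
  rw [finrank_adjoin_eq_orderOf, hK, ← (Nat.coprime_two_right.2 hodd).orderOf_pow]
  push_cast
  rw [neg_sq]

lemma natCard_nondegenerateSubspaces_eq_prod {M 𝕜 : Type*} [Field M] [Algebra M L] [Field 𝕜]
    [CharZero 𝕜] (hq : 2 ≤ q) {m r : ℕ} (hM : Nat.card M = (q ^ m) ^ 2)
    (hmn : m * Module.finrank M L = n) (hn : Odd n) (hr : r ≤ Module.finrank M L) :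
    (Nat.card (nondegenerateSubspaces q n r M L) : 𝕜) = ∏ j ∈ range r,
      ((-q : ℤ) ^ (n - m * r) * ((-q : ℤ) ^ n - (-q : ℤ) ^ (m * j)) /
        ((-q : ℤ) ^ (m * r) - (-q : ℤ) ^ (m * j)) : 𝕜) := by
  obtain ⟨l, hl⟩ := Nat.exists_eq_add_of_le hr
  obtain ⟨hm, hodd⟩ := Nat.odd_mul.1 (hmn ▸ hn)
  rw [hl] at hmn
  have hsub : n - m * r = m * l := by rw [← hmn, mul_add, Nat.add_sub_cancel_left]
  have hcount := natCard_nondegenerateSubspaces_mul_prod hM hodd hl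
  rw [show -((q ^ m : ℕ) : ℤ) = (-q) ^ m by rw [hm.neg_pow, Nat.cast_pow]] at hcount
  simp only [← pow_mul, nondegenerateSubspaces_pow, hmn] at hcount
  rw [prod_div_distrib, eq_div_iff, hsub]
  · exact_mod_cast hcount
  · refine prod_ne_zero_iff.2 fun j hj ↦ ?_
    have hQ : (2 : ℤ) ≤ |(-q : ℤ)| := by rwa [abs_neg, Nat.abs_cast, Nat.ofNat_le_cast]
    exact_mod_cast pow_sub_pow_ne_zero hQ (Nat.mul_lt_mul_of_pos_left (mem_range.1 hj) hm.pos)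

lemma neg_pow_eq_one_of_pow_eq_one {G : Type*} [Monoid G] {c : G} (hn : Odd n)
    (hc : c ^ (q ^ n + 1) = 1) : ((-q : ℤ) : ZMod (orderOf c)) ^ n = 1 := by
  have hzero := (ZMod.natCast_eq_zero_iff _ _).2 (orderOf_dvd_of_pow_eq_one hc)
  push_cast at hzero ⊢
  rw [hn.neg_pow, neg_eq_iff_add_eq_zero, hzero]

theorem ncard_smul_eq_self_eq_aeval (hq : 2 ≤ q) (hn : Odd n) (hk : k ≤ n)
    (hK : Nat.card K = q ^ 2) (hd : Module.finrank K L = n) {P : ℕ[X]}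
    (hP : aeval (RatFunc.X : RatFunc ℚ) P = sievingFunction q n k) {c : Lˣ}
    (hc : c ^ (q ^ n + 1) = 1) {ω : ℂ} (hω : orderOf ω = orderOf c) :
    ({W | W ∈ nondegenerateSubspaces q n k K L ∧ c • W = W}.ncard : ℂ) = aeval ω P := by
  have hL : Nat.card L = (q ^ n) ^ 2 := by
    rw [Module.natCard_eq_pow_finrank (K := K), hK, hd, pow_right_comm]
  have hfin : IsOfFinOrder ω := orderOf_pos_iff.1 (hω ▸ orderOf_pos c)
  have hω₀ : ω ≠ 0 := hfin.isUnit.ne_zero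
  have hωalg : IsAlgebraic ℚ ω := (IsIntegral.of_pow hfin.orderOf_pos
    (pow_orderOf_eq_one ω ▸ isIntegral_one)).isAlgebraic
  have hord : orderOf ω⁻¹ = orderOf c :=
    hω ▸ orderOf_eq_orderOf_iff.2 fun _ ↦ by rw [inv_pow, inv_eq_one]
  have hQ : (2 : ℤ) ≤ |(-q : ℤ)| := by rwa [abs_neg, Nat.abs_cast, Nat.ofNat_le_cast]
  have hQn := neg_pow_eq_one_of_pow_eq_one hn hc
  have hdeg := orderOf_neg_eq_finrank_adjoin hK hn hQn
  have hmn := Module.finrank_mul_finrank K K⟮(c : L)⟯ L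
  rw [← hord] at hQn hdeg
  refine (aeval_eq_of_tendsto_sievingProduct hn hk hP hωalg hω₀ ?_).symm
  by_cases hmk : Module.finrank K K⟮(c : L)⟯ ∣ k
  · obtain ⟨r, rfl⟩ := hmk
    have hM : Nat.card K⟮(c : L)⟯ = (q ^ Module.finrank K K⟮(c : L)⟯) ^ 2 := by
      rw [Module.natCard_eq_pow_finrank (K := K), hK, pow_right_comm]
    have hr : r ≤ Module.finrank K⟮(c : L)⟯ L :=
      Nat.le_of_mul_le_mul_left (hk.trans (hd.symm.trans hmn.symm).le) Module.finrank_pos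
    rw [setOf_smul_eq_self hL, Set.ncard_image_of_injective _
      (Submodule.restrictScalars_injective K _ L), ← Nat.card_coe_set_eq,
      natCard_nondegenerateSubspaces_eq_prod hq hM (hmn.trans hd) hn hr]
    exact tendsto_sievingProduct_mul hQ hn.pos.ne' (inv_ne_zero hω₀) hQn hdeg
  · have hempty : {W | W ∈ nondegenerateSubspaces q n k K L ∧ c • W = W} = ∅ :=
      Set.eq_empty_of_forall_notMem fun W hW ↦
        hmk (hW.1.1 ▸ finrank_adjoin_dvd_of_smul_eq_self hW.2)
    rw [hempty, Set.ncard_empty, Nat.cast_zero]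
    exact tendsto_sievingProduct_of_not_dvd hQ hn.pos.ne' (inv_ne_zero hω₀) hQn (hdeg ▸ hmk)

end FixedSubspaces

section SingerGroup

lemma orderOf_generator_pow {G : Type*} [Group G] {N : ℕ} (hN : 2 ≤ N)
    (hG : Nat.card G = N ^ 2 - 1) {γ : G} (hγ : ∀ x, x ∈ Subgroup.zpowers γ) :
    orderOf (γ ^ (N - 1)) = N + 1 := by
  have horder : orderOf γ = (N - 1) * (N + 1) := by
    rw [orderOf_eq_card_of_forall_mem_zpowers hγ, hG, mul_comm, ← Nat.sq_sub_sq, one_pow]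
  rw [orderOf_pow_of_dvd (by lia) ⟨_, horder⟩, horder, Nat.mul_div_cancel_left _ (by lia)]

lemma finrank_eq_of_natCard_eq {K L : Type*} [Field K] [Field L] [Algebra K L] [Finite L]
    {q n : ℕ} (hq : 2 ≤ q) (hK : Nat.card K = q ^ 2) (hL : Nat.card L = q ^ (2 * n)) :
    Module.finrank K L = n := by
  rw [Module.natCard_eq_pow_finrank (K := K), hK, ← pow_mul] at hL
  exact Nat.eq_of_mul_eq_mul_left two_pos (Nat.pow_right_injective hq hL)

end SingerGroup

end HermitianSieving

open HermitianSieving in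
theorem theorem5p4 (q n k : ℕ) (hq : IsPrimePow q) (hn : Odd n) (hk : k ≤ n)
    (K L : Type*) [Field K] [Field L] [Algebra K L]
    (hK : Nat.card K = q ^ 2) (hL : Nat.card L = q ^ (2 * n))
    (γ : Lˣ) (hγ : ∀ x : Lˣ, x ∈ Subgroup.zpowers γ) :
    Nat.card (Subgroup.zpowers (γ ^ (q ^ n - 1))) = q ^ n + 1 ∧
    ∃ P : Polynomial ℕ,
      Polynomial.aeval (RatFunc.X : RatFunc ℚ) P = sievingFunction q n k ∧
      CyclicSieving (Subgroup.zpowers (γ ^ (q ^ n - 1)))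
        (nondegenerateSubspaces q n k K L) P := by
  have hq₂ : 2 ≤ q := hq.two_le
  have : Finite L := Nat.finite_of_card_ne_zero (by rw [hL]; positivity)
  have hunits : Nat.card Lˣ = (q ^ n) ^ 2 - 1 := by rw [Nat.card_units, hL, pow_mul']
  have hcard : Nat.card (Subgroup.zpowers (γ ^ (q ^ n - 1))) = q ^ n + 1 := by
    rw [Nat.card_zpowers,
      orderOf_generator_pow (hq₂.trans (Nat.le_self_pow hn.pos.ne' q)) hunits hγ]
  have hpow (c : Subgroup.zpowers (γ ^ (q ^ n - 1))) : (c : Lˣ) ^ (q ^ n + 1) = 1 :=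
    hcard ▸ congrArg Subtype.val (pow_card_eq_one' (x := c))
  obtain ⟨P, hP⟩ := exists_aeval_eq_sievingFunction hq₂ hn hk
  exact ⟨hcard, P, hP, inferInstance, inferInstance, Set.toFinite _,
    fun c _ hW ↦ smul_mem_nondegenerateSubspaces (hpow c) hW,
    fun c _ hω ↦ ncard_smul_eq_self_eq_aeval hq₂ hn hk hK (finrank_eq_of_natCard_eq hq₂ hK hL) hP
      (hpow c) (hω.trans (Subgroup.orderOf_coe c).symm)⟩
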